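/- Let $n, N \ge 1$ and let $S_1,\dots,S_N:\mathbb{R}^n\to\mathbb{R}^n$ be contracting affine maps, $S_i(x)=A_ix+b_i$ with $A_i\in \mathrm{GL}(n,\mathbb{R})$ (contracting: $|S_i(x)-S_i(y)|\le c\,|x-y|$ for all $x,y$, with some $c\in(0,1)$). Let $C\subset\mathbb{R}^n$ be compact and let $F_C$ be the associated inhomogeneous self-affine set, i.e. the non-empty compact set with $$F_C=\bigcup_{i=1}^N S_i(F_C)\cup C .$$ Suppose that the condensation open set condition (COSC) holds: there is an open set $U$ with $C\subset U\setminus\bigcup_{i=1}^N\overline{S_i(U)}$, $S_i(U)\subset U$ for all $i$, and $S_i(U)\cap S_j(U)=\emptyset$ for $i\neq j$. Suppose moreover that $$\inf_{V}\mathcal{L}^{n-1}(\pi_V C)>0,$$ where $V$ runs over the $(n-1)$-dimensional linear subspaces of $\mathbb{R}^n$, $\pi_V$ is the orthogonal projection onto $V$, and $\mathcal{L}^{n-1}$ is $(n-1)$-dimensional Lebesgue measure on $V$. For $A\in\mathrm{GL}(n,\mathbb{R})$ with singular values $\alpha_1\ge\dots\ge\alpha_n>0$ let $\phi^0(A)=1$,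 $\phi^t(A)=\alpha_1\cdots\alpha_{m-1}\alpha_m^{t-m+1}$ for $0<t\le n$, where $m$ is the integer with $m-1<t\le m$, and $\phi^t(A)=|\det A|^{t/n}$ for $t>n$. For an affine map $S$ let $\phi^t(S)=\phi^t(A)$, where $A$ is the linear part of $S$. For $k\ge1$ let $s_k\ge0$ be the solution of $$\sum_{(i_1,\dots,i_k)\in\{1,\dots,N\}^k}\phi^{s_k}(S_{i_1}\circ\dots\circ S_{i_k})=1 .$$ Then the limit $s=\lim_{k\to\infty}s_k$ (the affinity dimension) exists and is uniquely determined, and $$\overline{\dim}_{\mathrm B}F_C=\max\{s,\overline{\dim}_{\mathrm B}C\},\qquad \max\{s,\underline{\dim}_{\mathrm B}C\}\le\underline{\dim}_{\mathrm B}F_C\le\max\{s,\overline{\dim}_{\mathrm B}C\}.$$ Here, for a non-empty bounded set $F$, $\overline{\dim}_{\mathrm B}F$ and $\underline{\dim}_{\mathrm B}F$ are the $\limsup$ and the $\liminf$, as $\delta\to0^+$, of $\log N_\delta(F)/(-\log\delta)$, where $N_\delta(F)$ is the minimum number of closed axis-parallel hypercubes of sidelength $\delta$ required to cover $F$. -/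

import Mathlib

open Filter Topology MeasureTheory

/-- Euclidean space of dimension `n`. -/
abbrev Euc (n : ℕ) : Type := EuclideanSpace ℝ (Fin n)

/-- A map is contracting if it is Lipschitz with some constant in `(0, 1)`. -/
def IsContracting {n : ℕ} (f : Euc n → Euc n) : Prop :=
  ∃ c : ℝ, 0 < c ∧ c < 1 ∧ ∀ x y : Euc n, dist (f x) (f y) ≤ c * dist x y

/-- `F` is the inhomogeneous attractor of the maps `S i` with condensation set `C`: it is
non-empty, compact and equal to `⋃ i, S i (F) ∪ C`. -/
structure IsInhomogeneousAttractor {n N : ℕ} (S : Fin N → (Euc n ≃ᵃ[ℝ] Euc n))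
    (C F : Set (Euc n)) : Prop where
  nonempty : F.Nonempty
  isCompact : IsCompact F
  eq_union : F = (⋃ i, S i '' F) ∪ C

/-- The condensation open set condition for the maps `S i` with condensation set `C`. -/
def CondensationOSC {n N : ℕ} (S : Fin N → (Euc n ≃ᵃ[ℝ] Euc n)) (C : Set (Euc n)) : Prop :=
  ∃ U : Set (Euc n), IsOpen U ∧ C ⊆ U \ ⋃ i, closure (S i '' U) ∧
    (∀ i, S i '' U ⊆ U) ∧ ∀ i j, i ≠ j → S i '' U ∩ S j '' U = ∅

/-- The composition `S_{w 0} ∘ ⋯ ∘ S_{w (k - 1)}` along a word `w` of length `k`. -/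
noncomputable def wordMap {n N : ℕ} (S : Fin N → (Euc n ≃ᵃ[ℝ] Euc n)) {k : ℕ} (w : Fin k → Fin N) :
    Euc n ≃ᵃ[ℝ] Euc n :=
  (List.ofFn fun j => S (w j)).prod

/-- Falconer's singular value function `φ^t`: it is `1` for `t = 0`, it is
`α_1 ⋯ α_{m-1} α_m ^ (t - m + 1)` for `0 < t ≤ n`, where `m = ⌈t⌉` is the integer with
`m - 1 < t ≤ m`, and it is `|det A| ^ (t / n)` for `t > n`.  (It is only used for `t ≥ 0`.)
Mathlib lists the singular values in decreasing order, starting from the index `0`, so that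
`α_j` is `A.singularValues (j - 1)`. -/
noncomputable def singularValueFunction {n : ℕ} (t : ℝ) (A : Euc n →ₗ[ℝ] Euc n) : ℝ :=
  if t ≤ 0 then 1
  else if t ≤ n then
    (∏ j ∈ Finset.range (⌈t⌉₊ - 1), A.singularValues j) *
      A.singularValues (⌈t⌉₊ - 1) ^ (t - (⌈t⌉₊ : ℝ) + 1)
  else |LinearMap.det A| ^ (t / n)

/-- `t` solves `∑ φ^t(S_w) = 1`, the sum being over all words `w` of length `k`. -/
def IsAffinityRoot {n N : ℕ} (S : Fin N → (Euc n ≃ᵃ[ℝ] Euc n)) (k : ℕ) (t : ℝ) : Prop :=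
  0 ≤ t ∧ ∑ w : Fin k → Fin N,
    singularValueFunction t ((wordMap S w).linear : Euc n →ₗ[ℝ] Euc n) = 1

/-- `s` is the affinity dimension of the maps `S i`: the limit of the solutions `s_k` of
`∑ φ^{s_k}(S_w) = 1` (sum over the words of length `k ≥ 1`). -/
def IsAffinityDimension {n N : ℕ} (S : Fin N → (Euc n ≃ᵃ[ℝ] Euc n)) (s : ℝ) : Prop :=
  ∃ r : ℕ → ℝ, (∀ k, 1 ≤ k → IsAffinityRoot S k (r k)) ∧ Tendsto r atTop (𝓝 s)

/-- The closed hypercube of sidelength `δ` with lowest corner `a`. -/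
def hypercube {n : ℕ} (a : Euc n) (δ : ℝ) : Set (Euc n) :=
  {x | ∀ i, a i ≤ x i ∧ x i ≤ a i + δ}

/-- The least number of hypercubes of sidelength `δ` that cover `F` (a bounded set). -/
noncomputable def cubeCoverNumber {n : ℕ} (δ : ℝ) (F : Set (Euc n)) : ℕ :=
  sInf {k | ∃ T : Finset (Euc n), T.card = k ∧ F ⊆ ⋃ a ∈ T, hypercube a δ}

/-- The upper box dimension of a non-empty bounded set.  (For such a set the quotient stays
bounded as `δ → 0`, so that the `limsup` in `ℝ` is the genuine one.) -/
noncomputable def upperBoxDim {n : ℕ} (F : Set (Euc n)) : ℝ :=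
  limsup (fun δ : ℝ => Real.log (cubeCoverNumber δ F) / -Real.log δ) (𝓝[>] 0)

/-- The lower box dimension of a non-empty bounded set. -/
noncomputable def lowerBoxDim {n : ℕ} (F : Set (Euc n)) : ℝ :=
  liminf (fun δ : ℝ => Real.log (cubeCoverNumber δ F) / -Real.log δ) (𝓝[>] 0)

/-- The infimum, over the `(n - 1)`-dimensional subspaces `V` of `ℝ^n` (for `n ≥ 1`), of the
`(n - 1)`-dimensional Lebesgue measure of the orthogonal projection of `C` onto `V`.
Here `volume` on `V` is Mathlib's Lebesgue measure of the inner product space `V`, which gives the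
unit cube of an orthonormal basis of `V` measure one. -/
noncomputable def infHyperplaneProjection {n : ℕ} (C : Set (Euc n)) : ENNReal :=
  ⨅ V : {V : Submodule ℝ (Euc n) // Module.finrank ℝ V = n - 1},
    (volume : Measure V.1) (V.1.orthogonalProjectionOnto '' C)

/-! Counting cubes is replaced by measuring volume: `cubeCoverNumber δ E * δ ^ n` is comparable to
`thickVol δ E` (`exists_thickVol_le`, `exists_cubeCoverNumber_le`), so box dimensions are read off
from the decay of the volume of neighbourhoods. By Fubini, the projection hypothesis says that
sweeping `C` by `±r` in any direction fills volume at least `κ * r` (`exists_mul_le_measure_sweep`).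
Hence `C` has lower box dimension at least `n - 1`, and only exponents `t` in `[n - 1, n]` matter.
There `φ^t(A) = |det A| α_n ^ (t - n)`: only the determinant and the smallest singular value enter.

Fix `δ` and extend words until `α_n` first drops below `δ`; it is then still comparable to `δ`.
Upper bound (`exists_thickVol_attractor_le`): `F` is the union of the pieces `S_l(C)` over the words
before stopping and `S_l(F)` over the stopped words. The `δ`-neighbourhood of `S_l(E)` lies in the
image under `S_l` of the `(δ / α_n)`-neighbourhood of `E`, so for `t` above the upper box dimension
of `C` each piece has volume at most a constant times `δ ^ (n - t) * φ^t(S_l)`. For `t > s` the sum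
of `φ^t` over all words converges. Lower bound (`exists_le_thickVol_attractor`): the sets `S_l(U)`
over the stopped words are disjoint. Each contains the image of `C` swept along the last singular
direction of `S_l`; this image is close to `F` and has volume at least a constant times `δ ^ (n - t)
* φ^t(S_l)`. For `t < s` the stopped sums of `φ^t` are bounded below (`one_le_mul_stopSum`).

Existence of `s` rests on the submultiplicativity of `φ^t` up to a constant, obtained from Horn's
inequality by Abel summation. A crude constant suffices, since it does not affect exponential rates.
-/

/-! ### Singular values and Horn's inequality. -/

/-- Singular value decomposition of an endomorphism of Euclidean space. -/
theorem exists_singularValue_decomposition {n : ℕ} (T : Euc n →ₗ[ℝ] Euc n) :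
    ∃ v u : OrthonormalBasis (Fin n) ℝ (Euc n), ∀ i, T (v i) = T.singularValues i • u i := by
  have hn : Module.finrank ℝ (Euc n) = n := by simp
  let v := T.isSymmetric_adjoint_comp_self.eigenvectorBasis hn
  have hv : ∀ i j, inner ℝ (T (v i)) (T (v j)) =
      if i = j then (T.singularValues i) ^ 2 else 0 := by
    intro i j
    have h1 : inner ℝ (T (v i)) (T (v j)) = inner ℝ (v i) ((T.adjoint ∘ₗ T) (v j)) := by
      rw [LinearMap.comp_apply, LinearMap.adjoint_inner_right]
    rw [h1, T.isSymmetric_adjoint_comp_self.apply_eigenvectorBasis hn, inner_smul_right,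
      orthonormal_iff_ite.1 v.orthonormal]
    split_ifs with h
    · subst h
      simp [T.sq_singularValues_fin hn]
    · simp
  -- The normalized images of the `v i` with non-zero singular value are orthonormal. The other `v
  -- i` are killed by `T`, so any completion to a basis works.
  let s : Set (Fin n) := {i | T.singularValues i ≠ 0}
  have ho : Orthonormal ℝ (s.domRestrict fun i => (T.singularValues i)⁻¹ • T (v i)) := by
    rw [orthonormal_iff_ite]
    rintro ⟨i, hi⟩ ⟨j, hj⟩
    have hi' : T.singularValues i ≠ 0 := hi
    change inner ℝ ((T.singularValues i)⁻¹ • T (v i)) ((T.singularValues j)⁻¹ • T (v j)) = _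
    simp only [inner_smul_left, inner_smul_right, hv, Subtype.mk.injEq]
    split_ifs with h
    · subst h
      simp
      field_simp
    · simp
  obtain ⟨u, hu⟩ := ho.exists_orthonormalBasis_extension_of_card_eq (by simp)
  refine ⟨v, u, fun i => ?_⟩
  by_cases hi : T.singularValues i = 0
  · have h0 := hv i i
    rw [if_pos rfl, hi] at h0
    simpa [hi] using h0
  · rw [hu i hi, smul_inv_smul₀ hi]

theorem apply_eq_sum_singularValues {n : ℕ} {T : Euc n →ₗ[ℝ] Euc n}
    {v u : OrthonormalBasis (Fin n) ℝ (Euc n)} (h : ∀ i, T (v i) = T.singularValues i • u i)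
    (x : Euc n) : T x = ∑ i : Fin n, (T.singularValues i * inner ℝ (v i) x) • u i := by
  conv_lhs => rw [← v.sum_repr x]
  simp only [map_sum, map_smul, h, smul_smul, v.repr_apply_apply]
  exact Finset.sum_congr rfl fun i _ => by rw [mul_comm]

theorem norm_apply_sq_eq_sum {n : ℕ} {T : Euc n →ₗ[ℝ] Euc n}
    {v u : OrthonormalBasis (Fin n) ℝ (Euc n)} (h : ∀ i, T (v i) = T.singularValues i • u i)
    (x : Euc n) : ‖T x‖ ^ 2 = ∑ i : Fin n, (T.singularValues i * inner ℝ (v i) x) ^ 2 := by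
  rw [apply_eq_sum_singularValues h, ← u.sum_sq_norm_inner_right]
  refine Finset.sum_congr rfl fun i _ => ?_
  rw [u.orthonormal.inner_right_fintype, Real.norm_eq_abs, sq_abs]

/-- A product of distinct terms of an antitone sequence is at most the product of its first
terms. -/
theorem prod_apply_le_prod_range {n m : ℕ} {d : ℕ → ℝ} (hd : Antitone d) (h0 : ∀ i, 0 ≤ d i)
    {f : Fin m → Fin n} (hf : Function.Injective f) :
    ∏ i, d (f i) ≤ ∏ j ∈ Finset.range m, d j := by
  classical
  let s : Finset ℕ := Finset.univ.image fun i => (f i : ℕ)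
  have hinj : Function.Injective fun i => (f i : ℕ) := Fin.val_injective.comp hf
  have hs : s.card = m := by simp [s, Finset.card_image_of_injective _ hinj]
  have h1 : ∏ i, d (f i) = ∏ x ∈ s, d x := by
    rw [Finset.prod_image fun a _ b _ hab => hinj hab]
  have h2 : ∏ x ∈ s, d x = ∏ i : Fin m, d (s.orderEmbOfFin hs i) := by
    conv_lhs => rw [← s.image_orderEmbOfFin_univ hs]
    rw [Finset.prod_image fun a _ b _ hab => (s.orderEmbOfFin hs).injective hab]
  rw [h1, h2, ← Fin.prod_univ_eq_prod_range]
  refine Finset.prod_le_prod (fun i _ => h0 _) fun i _ => hd ?_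
  have key : ∀ k (hk : k < m), k ≤ s.orderEmbOfFin hs ⟨k, hk⟩ := by
    intro k
    induction k with
    | zero => intro _; exact Nat.zero_le _
    | succ k ih =>
      intro hk
      have := (s.orderEmbOfFin hs).strictMono
        (show (⟨k, by omega⟩ : Fin m) < ⟨k + 1, hk⟩ from by simp [Fin.lt_def])
      have := ih (by omega)
      omega
  exact key i i.2

/-- A Cauchy–Binet type bound for a determinant with a diagonal matrix in the middle. -/
theorem abs_det_mul_diagonal_mul_le {m n : ℕ} {d : ℕ → ℝ} (hd : Antitone d) (h0 : ∀ i, 0 ≤ d i)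
    {X : Matrix (Fin m) (Fin n) ℝ} (hX : ∀ i j, |X i j| ≤ 1) {Z : Matrix (Fin n) (Fin m) ℝ}
    {B : ℝ} (hB : 0 ≤ B) (hZ : ∀ f : Fin m → Fin n, |(Z.submatrix f id).det| ≤ B) :
    |(X * Matrix.diagonal (fun k : Fin n => d k) * Z).det| ≤
      (n : ℝ) ^ m * (∏ j ∈ Finset.range m, d j) * B := by
  have hP : 0 ≤ ∏ j ∈ Finset.range m, d j := Finset.prod_nonneg fun j _ => h0 j
  have hrow : X * Matrix.diagonal (fun k : Fin n => d k) * Z =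
      fun i => ∑ k : Fin n, (X i k * d k) • Z k := by
    ext i j
    rw [Matrix.mul_apply]
    simp only [Matrix.mul_diagonal, Finset.sum_apply, Pi.smul_apply, smul_eq_mul]
  have hdet : (X * Matrix.diagonal (fun k : Fin n => d k) * Z).det =
      ∑ f : Fin m → Fin n, (∏ i, X i (f i) * d (f i)) * (Z.submatrix f id).det := by
    rw [hrow]
    change (Matrix.detRowAlternating.toMultilinearMap : MultilinearMap ℝ _ ℝ) _ = _
    rw [MultilinearMap.map_sum]
    refine Finset.sum_congr rfl fun f _ => ?_
    rw [MultilinearMap.map_smul_univ]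
    rfl
  rw [hdet]
  refine (Finset.abs_sum_le_sum_abs _ _).trans ?_
  -- A non-injective `f` repeats a row, so its minor vanishes; an injective `f` picks distinct
  -- diagonal entries.
  have hterm : ∀ f ∈ (Finset.univ : Finset (Fin m → Fin n)),
      |(∏ i, X i (f i) * d (f i)) * (Z.submatrix f id).det| ≤
        (∏ j ∈ Finset.range m, d j) * B := by
    intro f _
    by_cases hf : Function.Injective f
    · rw [abs_mul]
      refine mul_le_mul ?_ (hZ f) (abs_nonneg _) hP
      rw [Finset.abs_prod]
      refine le_trans (Finset.prod_le_prod (fun i _ => abs_nonneg _) fun i _ => ?_)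
        (prod_apply_le_prod_range hd h0 hf)
      rw [abs_mul, abs_of_nonneg (h0 _)]
      exact mul_le_of_le_one_left (h0 _) (hX _ _)
    · simp only [Function.Injective, not_forall] at hf
      obtain ⟨i, j, hij, hne⟩ := hf
      rw [Matrix.det_zero_of_row_eq hne (by ext k; simp [hij])]
      simpa using mul_nonneg hP hB
  refine (Finset.sum_le_sum hterm).trans (le_of_eq ?_)
  simp [mul_assoc]

theorem abs_det_le_factorial {m : ℕ} {Y : Matrix (Fin m) (Fin m) ℝ} (hY : ∀ i j, |Y i j| ≤ 1) :
    |Y.det| ≤ m.factorial := by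
  have := Matrix.det_le (abv := IsAbsoluteValue.toAbsoluteValue (abs : ℝ → ℝ)) (x := 1) hY
  simpa using this

/-- Horn's inequality for the products of the largest singular values, up to a constant. -/
theorem prod_singularValues_comp_le {n m : ℕ} (hm : m ≤ n) (A B : Euc n →ₗ[ℝ] Euc n) :
    ∏ j ∈ Finset.range m, (A ∘ₗ B).singularValues j ≤
      ((n : ℝ) ^ m * (n : ℝ) ^ m * m.factorial) *
        ((∏ j ∈ Finset.range m, A.singularValues j) *
          ∏ j ∈ Finset.range m, B.singularValues j) := by
  obtain ⟨v, u, h⟩ := exists_singularValue_decomposition (A ∘ₗ B)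
  obtain ⟨vA, uA, hA⟩ := exists_singularValue_decomposition A
  obtain ⟨vB, uB, hB⟩ := exists_singularValue_decomposition B
  let c : Fin m → Fin n := Fin.castLE hm
  let X : Matrix (Fin m) (Fin n) ℝ := fun i k => inner ℝ (u (c i)) (uA k)
  let Q : Matrix (Fin n) (Fin n) ℝ := fun k l => inner ℝ (vA k) (uB l)
  let Y : Matrix (Fin n) (Fin m) ℝ := fun l j => inner ℝ (vB l) (v (c j))
  have hbd : ∀ (a b : OrthonormalBasis (Fin n) ℝ (Euc n)) i j, |inner ℝ (a i) (b j)| ≤ 1 := by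
    intro a b i j
    simpa using abs_real_inner_le_norm (a i) (b j)
  -- The matrix of `A ∘ B` between its first `m` right and left singular vectors is diagonal;
  -- inserting the singular bases of `A` and of `B` factors it.
  have hprod : X * Matrix.diagonal (fun k : Fin n => A.singularValues k) *
      (Q * Matrix.diagonal (fun k : Fin n => B.singularValues k) * Y) =
      Matrix.diagonal fun j : Fin m => (A ∘ₗ B).singularValues j := by
    ext i j
    have h1 : inner ℝ (u (c i)) (A (B (v (c j)))) =
        Matrix.diagonal (fun j : Fin m => (A ∘ₗ B).singularValues j) i j := by
      have := h (c j)
      rw [LinearMap.comp_apply] at this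
      rw [this, inner_smul_right, orthonormal_iff_ite.1 u.orthonormal, Matrix.diagonal_apply]
      have hc : c i = c j ↔ i = j := (Fin.castLE_injective hm).eq_iff
      by_cases hij : i = j
      · subst hij; simp [c]
      · simp [hc, hij]
    rw [← h1, apply_eq_sum_singularValues hA, apply_eq_sum_singularValues hB]
    rw [Matrix.mul_apply, inner_sum]
    refine Finset.sum_congr rfl fun k _ => ?_
    rw [Matrix.mul_diagonal, Matrix.mul_apply, inner_smul_right, inner_sum]
    have h2 : ∀ l, (Q * Matrix.diagonal fun k : Fin n => B.singularValues k) k l * Y l j =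
        inner ℝ (vA k) ((B.singularValues l * inner ℝ (vB l) (v (c j))) • uB l) := by
      intro l
      rw [Matrix.mul_diagonal, inner_smul_right]
      simp only [Q, Y]
      ring
    simp only [h2, X]
    ring
  have hdet := congrArg Matrix.det hprod
  rw [Matrix.det_diagonal, Fin.prod_univ_eq_prod_range (fun j => (A ∘ₗ B).singularValues j)]
    at hdet
  rw [← hdet]
  have hPB : 0 ≤ ∏ j ∈ Finset.range m, B.singularValues j :=
    Finset.prod_nonneg fun j _ => B.singularValues_nonneg j
  -- The bound is used twice, once per diagonal factor, each time at the cost of `n ^ m`; the minors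
  -- of `Y` cost `m!`.
  refine (le_abs_self _).trans ((abs_det_mul_diagonal_mul_le A.singularValues_antitone
    A.singularValues_nonneg (fun i j => hbd _ _ _ _)
    (B := (n : ℝ) ^ m * (∏ j ∈ Finset.range m, B.singularValues j) * m.factorial)
    (by positivity) fun f => ?_).trans (le_of_eq (by ring)))
  have hsub : (Q * Matrix.diagonal (fun k : Fin n => B.singularValues k) * Y).submatrix f id =
      Q.submatrix f id * Matrix.diagonal (fun k : Fin n => B.singularValues k) * Y := by
    ext i j
    rw [Matrix.submatrix_apply, Matrix.mul_apply, Matrix.mul_apply]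
    simp [Matrix.mul_diagonal]
  rw [hsub]
  exact abs_det_mul_diagonal_mul_le B.singularValues_antitone B.singularValues_nonneg
    (fun i j => hbd _ _ _ _) (by positivity)
    fun g => abs_det_le_factorial fun i j => hbd _ _ _ _

theorem singularValues_pos {n : ℕ} {A : Euc n →ₗ[ℝ] Euc n} (hA : Function.Injective A) {j : ℕ}
    (hj : j < n) : 0 < A.singularValues j :=
  A.injective_iff_forall_lt_finrank_singularValues_pos.1 hA j (by simpa using hj)

theorem prod_singularValues_eq_abs_det {n : ℕ} (A : Euc n →ₗ[ℝ] Euc n) :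
    ∏ j ∈ Finset.range n, A.singularValues j = |LinearMap.det A| := by
  have := A.normDet_eq_prod_singularValues
  rw [A.normDet_eq_abs_det] at this
  simpa using this.symm

theorem exists_norm_one_norm_apply_eq_singularValue {n : ℕ} (A : Euc n →ₗ[ℝ] Euc n) {j : ℕ}
    (hj : j < n) : ∃ x, ‖x‖ = 1 ∧ ‖A x‖ = A.singularValues j := by
  obtain ⟨v, u, h⟩ := exists_singularValue_decomposition A
  refine ⟨v ⟨j, hj⟩, by simp, ?_⟩
  rw [h, norm_smul]
  simp [A.singularValues_nonneg]

theorem singularValues_le_of_norm_apply_le {n : ℕ} {A : Euc n →ₗ[ℝ] Euc n} {c : ℝ}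
    (h : ∀ x, ‖A x‖ ≤ c * ‖x‖) {j : ℕ} (hj : j < n) : A.singularValues j ≤ c := by
  obtain ⟨x, hx, hA⟩ := exists_norm_one_norm_apply_eq_singularValue A hj
  simpa [hA, hx] using h x

theorem le_singularValues_of_le_norm_apply {n : ℕ} {A : Euc n →ₗ[ℝ] Euc n} {c : ℝ}
    (h : ∀ x, c * ‖x‖ ≤ ‖A x‖) {j : ℕ} (hj : j < n) : c ≤ A.singularValues j := by
  obtain ⟨x, hx, hA⟩ := exists_norm_one_norm_apply_eq_singularValue A hj
  simpa [hA, hx] using h x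

theorem singularValue_mul_norm_le_norm_apply {n : ℕ} (A : Euc n →ₗ[ℝ] Euc n) (x : Euc n) :
    A.singularValues (n - 1) * ‖x‖ ≤ ‖A x‖ := by
  obtain ⟨v, u, h⟩ := exists_singularValue_decomposition A
  refine le_of_sq_le_sq ?_ (norm_nonneg _)
  rw [norm_apply_sq_eq_sum h, mul_pow, ← v.sum_sq_norm_inner_right x, Finset.mul_sum]
  refine Finset.sum_le_sum fun i _ => ?_
  rw [mul_pow, Real.norm_eq_abs, sq_abs]
  have h1 : A.singularValues (n - 1) ≤ A.singularValues i :=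
    A.singularValues_antitone (by omega)
  have h2 := A.singularValues_nonneg (n - 1)
  gcongr

/-! ### The singular value function as a product of powers. -/

/-- The exponent of the `j`-th singular value in the singular value function. -/
noncomputable def svExponent (n j : ℕ) (t : ℝ) : ℝ := max 0 (min 1 (t - j)) + max 0 (t - n) / n

theorem svExponent_nonneg (n j : ℕ) (t : ℝ) : 0 ≤ svExponent n j t := by
  unfold svExponent; positivity

theorem svExponent_continuous (n j : ℕ) : Continuous (svExponent n j) := by
  unfold svExponent; fun_prop

theorem svExponent_mono (n j : ℕ) : Monotone (svExponent n j) := by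
  intro s t h
  unfold svExponent
  gcongr

theorem svExponent_antitone (n : ℕ) (t : ℝ) : Antitone fun j => svExponent n j t := by
  intro i j h
  have : (i : ℝ) ≤ j := by exact_mod_cast h
  simp only [svExponent]
  gcongr

theorem sum_max_min_sub {n : ℕ} {t : ℝ} (ht : 0 ≤ t) :
    ∑ j ∈ Finset.range n, max 0 (min 1 (t - j)) = min t n := by
  induction n with
  | zero => simp [ht]
  | succ n ih =>
    rw [Finset.sum_range_succ, ih]
    push_cast
    rcases le_total t n with h | h
    · rw [min_eq_left h, min_eq_left (show t ≤ n + 1 by linarith),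
        min_eq_right (show t - n ≤ 1 by linarith), max_eq_left (by linarith), add_zero]
    · rw [min_eq_right h]
      rcases le_total t (n + 1) with h' | h'
      · rw [min_eq_left h', min_eq_right (by linarith), max_eq_right (by linarith)]
        ring
      · rw [min_eq_right h', min_eq_left (by linarith), max_eq_right (by linarith)]

/-- This is the homogeneity of degree `t` of `φ^t`. The second term of `svExponent` spreads the
excess `t - n` evenly over the `n` singular values. -/
theorem sum_svExponent {n : ℕ} (hn : 1 ≤ n) {t : ℝ} (ht : 0 ≤ t) :
    ∑ j ∈ Finset.range n, svExponent n j t = t := by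
  have hn' : (n : ℝ) ≠ 0 := by positivity
  simp only [svExponent, Finset.sum_add_distrib, sum_max_min_sub ht]
  simp only [Finset.sum_const, Finset.card_range, nsmul_eq_mul]
  rw [mul_div_cancel₀ _ hn']
  rcases le_total t n with h | h
  · rw [min_eq_left h, max_eq_left (by linarith), add_zero]
  · rw [min_eq_right h, max_eq_right (by linarith)]; ring

/-- A single formula for the three cases. The exponents are continuous and increasing in `t`, which
gives continuity and decay, and decreasing in `j`, which is what Abel summation needs. -/
theorem singularValueFunction_eq_prod {n : ℕ} (hn : 1 ≤ n) {A : Euc n →ₗ[ℝ] Euc n} {t : ℝ}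
    (ht : 0 ≤ t) :
    singularValueFunction t A = ∏ j ∈ Finset.range n, A.singularValues j ^ svExponent n j t := by
  have hn' : (n : ℝ) ≠ 0 := by positivity
  have hn0 : (0 : ℝ) < n := by positivity
  unfold singularValueFunction
  split_ifs with h0 h1
  · obtain rfl : t = 0 := le_antisymm h0 ht
    symm
    refine Finset.prod_eq_one fun j _ => ?_
    have : svExponent n j 0 = 0 := by
      simp [svExponent]
    rw [this, Real.rpow_zero]
  · push Not at h0
    obtain ⟨m, hm⟩ : ∃ m, ⌈t⌉₊ = m + 1 :=
      Nat.exists_eq_succ_of_ne_zero (Nat.ceil_pos.2 h0).ne'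
    have hmn : m + 1 ≤ n := by rw [← hm]; exact Nat.ceil_le.2 h1
    have ht1 : t ≤ m + 1 := by
      have := Nat.le_ceil t; rw [hm] at this; exact_mod_cast this
    have ht2 : (m : ℝ) < t := by
      have := Nat.ceil_lt_add_one h0.le; rw [hm] at this; push_cast at this; linarith
    have he : ∀ j, svExponent n j t = max 0 (min 1 (t - j)) := by
      intro j
      simp [svExponent, h1]
    rw [← Finset.prod_range_mul_prod_Ico _ hmn, Finset.prod_range_succ, hm]
    rw [Finset.prod_eq_one (s := Finset.Ico (m + 1) n), mul_one]
    · congr 1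
      · refine Finset.prod_congr rfl fun j hj => ?_
        have hj' : (j : ℝ) + 1 ≤ m := by
          exact_mod_cast Finset.mem_range.1 hj
        rw [he, min_eq_left (by linarith), max_eq_right (by linarith), Real.rpow_one]
      · rw [he, min_eq_right (by linarith), max_eq_right (by linarith)]
        congr 1
        push_cast
        ring
    · intro j hj
      have hj' : (m : ℝ) + 1 ≤ j := by exact_mod_cast (Finset.mem_Ico.1 hj).1
      rw [he, min_eq_right (by linarith), max_eq_left (by linarith), Real.rpow_zero]
  · push Not at h1
    rw [← prod_singularValues_eq_abs_det,
      ← Real.finsetProd_rpow _ _ fun j _ => A.singularValues_nonneg j]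
    refine Finset.prod_congr rfl fun j hj => ?_
    have hj' : (j : ℝ) + 1 ≤ n := by exact_mod_cast Finset.mem_range.1 hj
    congr 1
    rw [svExponent, min_eq_left (by linarith), max_eq_right (by linarith),
      max_eq_right (by linarith)]
    field_simp
    ring

theorem singularValueFunction_pos {n : ℕ} (hn : 1 ≤ n) {A : Euc n →ₗ[ℝ] Euc n}
    (hA : Function.Injective A) {t : ℝ} (ht : 0 ≤ t) : 0 < singularValueFunction t A := by
  rw [singularValueFunction_eq_prod hn ht]
  exact Finset.prod_pos fun j hj =>
    Real.rpow_pos_of_pos (singularValues_pos hA (Finset.mem_range.1 hj)) _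

theorem singularValueFunction_continuousOn {n : ℕ} (hn : 1 ≤ n) {A : Euc n →ₗ[ℝ] Euc n}
    (hA : Function.Injective A) :
    ContinuousOn (fun t => singularValueFunction t A) (Set.Ici 0) := by
  refine ContinuousOn.congr (Continuous.continuousOn ?_)
    fun t ht => singularValueFunction_eq_prod hn ht
  refine continuous_finsetProd _ fun j hj => ?_
  exact continuous_const.rpow (svExponent_continuous n j) fun _ =>
    Or.inl (singularValues_pos hA (Finset.mem_range.1 hj)).ne'

theorem singularValueFunction_add_le {n : ℕ} (hn : 1 ≤ n) {A : Euc n →ₗ[ℝ] Euc n}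
    (hA : Function.Injective A) {c : ℝ} (hc : ∀ j < n, A.singularValues j ≤ c) {s t : ℝ}
    (hs : 0 ≤ s) (hst : s ≤ t) :
    singularValueFunction t A ≤ c ^ (t - s) * singularValueFunction s A := by
  have hc0 : 0 < c := (singularValues_pos hA hn).trans_le (hc 0 hn)
  rw [singularValueFunction_eq_prod hn hs, singularValueFunction_eq_prod hn (hs.trans hst)]
  have h1 : c ^ (t - s) = ∏ j ∈ Finset.range n, c ^ (svExponent n j t - svExponent n j s) := by
    rw [← Real.rpow_sum_of_pos hc0, Finset.sum_sub_distrib, sum_svExponent hn hs,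
      sum_svExponent hn (hs.trans hst)]
  rw [h1, ← Finset.prod_mul_distrib]
  refine Finset.prod_le_prod (fun j hj => Real.rpow_nonneg (A.singularValues_nonneg j) _)
    fun j hj => ?_
  have hσ := singularValues_pos hA (Finset.mem_range.1 hj)
  calc A.singularValues j ^ svExponent n j t
      = A.singularValues j ^ (svExponent n j t - svExponent n j s) *
        A.singularValues j ^ svExponent n j s := by rw [← Real.rpow_add hσ]; simp
    _ ≤ _ := by
      gcongr
      · exact sub_nonneg.2 (svExponent_mono n j hst)
      · exact hc j (Finset.mem_range.1 hj)

/-- In this range only the last exponent can differ from 1. The right-hand side has a geometric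
meaning: a volume factor and a thickness. -/
theorem singularValueFunction_eq_abs_det_mul {n : ℕ} (hn : 1 ≤ n) {A : Euc n →ₗ[ℝ] Euc n}
    (hA : Function.Injective A) {t : ℝ} (ht : (n : ℝ) - 1 ≤ t) (htn : t ≤ n) :
    singularValueFunction t A = |LinearMap.det A| * A.singularValues (n - 1) ^ (t - n) := by
  obtain ⟨m, rfl⟩ : ∃ m, n = m + 1 := ⟨n - 1, by omega⟩
  push_cast at ht htn
  have ht0 : 0 ≤ t := by linarith [(Nat.cast_nonneg m : (0 : ℝ) ≤ m)]
  have he : ∀ j, svExponent (m + 1) j t = max 0 (min 1 (t - j)) := by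
    intro j
    simp [svExponent, htn]
  rw [singularValueFunction_eq_prod hn ht0, ← prod_singularValues_eq_abs_det,
    Finset.prod_range_succ, Finset.prod_range_succ, Nat.add_sub_cancel, mul_assoc]
  have hσ := singularValues_pos hA (Nat.lt_succ_self m)
  congr 1
  · refine Finset.prod_congr rfl fun j hj => ?_
    have hj' : (j : ℝ) + 1 ≤ m := by exact_mod_cast Finset.mem_range.1 hj
    rw [he, min_eq_left (by linarith), max_eq_right (by linarith), Real.rpow_one]
  · rw [he, min_eq_right (by linarith), max_eq_right (by linarith)]
    nth_rw 2 [← Real.rpow_one (A.singularValues m)]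
    rw [← Real.rpow_add hσ]
    congr 1
    push_cast
    ring

/-- Abel summation: an antitone nonnegative weight does not increase a bound on partial sums. -/
theorem sum_mul_le_of_partial_sums_le {e x : ℕ → ℝ} (he : Antitone e) (h0 : ∀ j, 0 ≤ e j) {L : ℝ}
    {n : ℕ} (hx : ∀ m ≤ n, ∑ j ∈ Finset.range m, x j ≤ L) :
    ∑ j ∈ Finset.range n, e j * x j ≤ e 0 * L := by
  have key : ∀ m ≤ n, ∑ j ∈ Finset.range m, e j * x j - e m * ∑ j ∈ Finset.range m, x j ≤
      (e 0 - e m) * L := by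
    intro m
    induction m with
    | zero => simp
    | succ m ih =>
      intro hm
      have h1 := ih (by omega)
      have h2 := mul_le_mul_of_nonneg_left (hx (m + 1) hm) (sub_nonneg.2 (he (Nat.le_succ m)))
      rw [Finset.sum_range_succ] at h2 ⊢
      rw [Finset.sum_range_succ (fun j => x j)]
      simp only [Nat.succ_eq_add_one] at h2
      nlinarith
  have h1 := key n le_rfl
  have h2 := mul_le_mul_of_nonneg_left (hx n le_rfl) (h0 n)
  linarith

/-- The singular value function is submultiplicative up to a constant. -/
theorem exists_singularValueFunction_comp_le {n : ℕ} (hn : 1 ≤ n) {t : ℝ} (ht : 0 ≤ t) :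
    ∃ K : ℝ, 1 ≤ K ∧ ∀ A B : Euc n →ₗ[ℝ] Euc n, Function.Injective A → Function.Injective B →
      singularValueFunction t (A ∘ₗ B) ≤
        K * (singularValueFunction t A * singularValueFunction t B) := by
  set M : ℝ := (n : ℝ) ^ n * (n : ℝ) ^ n * n.factorial with hM
  have hn1 : (1 : ℝ) ≤ n := by exact_mod_cast hn
  have hM1 : 1 ≤ M := by
    have h1 : (1 : ℝ) ≤ (n : ℝ) ^ n := one_le_pow₀ hn1
    have h2 : (1 : ℝ) ≤ n.factorial := by exact_mod_cast Nat.factorial_pos n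
    rw [hM]
    exact one_le_mul_of_one_le_of_one_le (one_le_mul_of_one_le_of_one_le h1 h1) h2
  have hlogM : 0 ≤ Real.log M := Real.log_nonneg hM1
  refine ⟨Real.exp (svExponent n 0 t * Real.log M),
    Real.one_le_exp (mul_nonneg (svExponent_nonneg _ _ _) hlogM), fun A B hA hB => ?_⟩
  have hAB : Function.Injective (A ∘ₗ B) := hA.comp hB
  have hlog : ∀ {T : Euc n →ₗ[ℝ] Euc n}, Function.Injective T →
      Real.log (singularValueFunction t T) =
        ∑ j ∈ Finset.range n, svExponent n j t * Real.log (T.singularValues j) := by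
    intro T hT
    rw [singularValueFunction_eq_prod hn ht, Real.log_prod]
    · exact Finset.sum_congr rfl fun j hj =>
        Real.log_rpow (singularValues_pos hT (Finset.mem_range.1 hj)) _
    · exact fun j hj =>
        (Real.rpow_pos_of_pos (singularValues_pos hT (Finset.mem_range.1 hj)) _).ne'
  have hA0 := singularValueFunction_pos hn hA ht
  have hB0 := singularValueFunction_pos hn hB ht
  have hAB0 := singularValueFunction_pos hn hAB ht
  rw [← Real.log_le_log_iff hAB0 (by positivity), Real.log_mul (by positivity) (by positivity),
    Real.log_mul hA0.ne' hB0.ne', Real.log_exp, hlog hA, hlog hB, hlog hAB]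
  -- After taking logarithms, Horn's inequality bounds the partial sums by `log M`, uniformly in `m
  -- ≤ n`, and the antitone weights `svExponent` preserve such a bound.
  have key := sum_mul_le_of_partial_sums_le (svExponent_antitone n t)
    (fun j => svExponent_nonneg n j t) (n := n) (L := Real.log M)
    (x := fun j => Real.log ((A ∘ₗ B).singularValues j) -
      (Real.log (A.singularValues j) + Real.log (B.singularValues j))) ?_
  · simp only [mul_sub, mul_add, Finset.sum_sub_distrib, Finset.sum_add_distrib] at key
    linarith
  · intro m hm
    have hpos : ∀ {T : Euc n →ₗ[ℝ] Euc n}, Function.Injective T →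
        ∀ j ∈ Finset.range m, 0 < T.singularValues j := fun hT j hj =>
      singularValues_pos hT ((Finset.mem_range.1 hj).trans_le hm)
    have hPA := Finset.prod_pos (hpos hA)
    have hPB := Finset.prod_pos (hpos hB)
    rw [Finset.sum_sub_distrib, Finset.sum_add_distrib,
      ← Real.log_prod fun j hj => (hpos hAB j hj).ne',
      ← Real.log_prod fun j hj => (hpos hA j hj).ne',
      ← Real.log_prod fun j hj => (hpos hB j hj).ne',
      sub_le_iff_le_add, ← Real.log_mul hPA.ne' hPB.ne', ← Real.log_mul (by positivity)
      (by positivity)]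
    refine Real.log_le_log (Finset.prod_pos (hpos hAB))
      ((prod_singularValues_comp_le hm A B).trans ?_)
    gcongr
    rw [hM]
    have : m.factorial ≤ n.factorial := Nat.factorial_le hm
    gcongr

/-! ### Pressure: existence of the affinity dimension. -/

/-- A family of level sums, one function of the exponent for each level, that decays exponentially
in the exponent and is submultiplicative in the level up to a constant. -/
structure IsPressureFamily (c : ℝ) (Z : ℕ → ℝ → ℝ) : Prop where
  c_pos : 0 < c
  c_lt_one : c < 1
  pos : ∀ k t, 0 ≤ t → 0 < Z k t
  continuousOn : ∀ k, ContinuousOn (Z k) (Set.Ici 0)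
  decay : ∀ k s t, 0 ≤ s → s ≤ t → Z k t ≤ (c ^ (t - s)) ^ k * Z k s
  one_le_zero : ∀ k, 1 ≤ Z k 0
  submul : ∀ t, 0 ≤ t → ∃ K, 1 ≤ K ∧ ∀ j k, Z (j + k) t ≤ K * (Z j t * Z k t)

namespace IsPressureFamily

variable {c : ℝ} {Z : ℕ → ℝ → ℝ}

theorem rpow_pos (h : IsPressureFamily c Z) (t : ℝ) : 0 < c ^ t := Real.rpow_pos_of_pos h.c_pos t

theorem rpow_lt_one (h : IsPressureFamily c Z) {t : ℝ} (ht : 0 < t) : c ^ t < 1 :=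
  Real.rpow_lt_one h.c_pos.le h.c_lt_one ht

theorem lt_of_lt (h : IsPressureFamily c Z) {k : ℕ} (hk : 1 ≤ k) {s t : ℝ} (hs : 0 ≤ s)
    (hst : s < t) : Z k t < Z k s := by
  refine (h.decay k s t hs hst.le).trans_lt ?_
  exact mul_lt_of_lt_one_left (h.pos k s hs)
    (pow_lt_one₀ (h.rpow_pos _).le (h.rpow_lt_one (sub_pos.2 hst)) (by omega))

theorem le_of_le (h : IsPressureFamily c Z) (k : ℕ) {s t : ℝ} (hs : 0 ≤ s)
    (hst : s ≤ t) : Z k t ≤ Z k s := by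
  refine (h.decay k s t hs hst).trans ?_
  exact mul_le_of_le_one_left (h.pos k s hs).le
    (pow_le_one₀ (h.rpow_pos _).le
      (Real.rpow_le_one h.c_pos.le h.c_lt_one.le (sub_nonneg.2 hst)))

theorem root_lt (h : IsPressureFamily c Z) {k : ℕ} {r t : ℝ} (ht : 0 ≤ t)
    (hZ : Z k r = 1) (hlt : Z k t < 1) : r < t := by
  by_contra! hle
  have := h.le_of_le k ht hle
  linarith

theorem mul_add_le (h : IsPressureFamily c Z) {t K : ℝ} (ht : 0 ≤ t) (hK : 1 ≤ K)
    (hs : ∀ j k, Z (j + k) t ≤ K * (Z j t * Z k t)) (k m i : ℕ) :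
    Z (m * k + i) t ≤ (K * Z k t) ^ m * Z i t := by
  induction m with
  | zero => simp
  | succ m ih =>
    rw [show (m + 1) * k + i = k + (m * k + i) by ring]
    refine (hs _ _).trans ?_
    rw [pow_succ', mul_assoc (K * Z k t), mul_assoc K]
    have := (h.pos k t ht).le
    gcongr

/-- The sums at exponent 0 grow at most like `q ^ k`, and a large exponent `B` makes the decay `c ^
B` win. This bounds all roots at once. -/
theorem exists_bound (h : IsPressureFamily c Z) : ∃ B, 0 ≤ B ∧ ∀ k, 1 ≤ k → Z k B < 1 := by
  obtain ⟨K, hK, hs⟩ := h.submul 0 le_rfl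
  set q := K * Z 1 0 with hq
  set M := q * Z 0 0 + q + 1 with hM
  have hq0 : 0 < q := mul_pos (by linarith) (h.pos 1 0 le_rfl)
  have hq1 : 1 ≤ q := one_le_mul_of_one_le_of_one_le hK (h.one_le_zero 1)
  have hZ0 := h.one_le_zero 0
  have hlim : Tendsto (fun B : ℕ => c ^ B) atTop (𝓝 0) :=
    tendsto_pow_atTop_nhds_zero_of_lt_one h.c_pos.le h.c_lt_one
  obtain ⟨B, hB⟩ := (hlim.eventually_lt_const (show 0 < (q * Z 0 0)⁻¹ by positivity)).exists
  refine ⟨B, by positivity, fun k hk => ?_⟩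
  have h1 := h.decay k 0 B le_rfl (by positivity)
  have h2 : Z k 0 ≤ q ^ k * Z 0 0 := by
    have := h.mul_add_le le_rfl hK hs 1 k 0
    simpa using this
  rw [sub_zero, Real.rpow_natCast] at h1
  refine h1.trans_lt ?_
  have hcB : (c ^ B * (q * Z 0 0)) < 1 := by
    rwa [← lt_div_iff₀ (by positivity), one_div]
  have hc0 : 0 < c ^ B := pow_pos h.c_pos B
  calc (c ^ B) ^ k * Z k 0 ≤ (c ^ B) ^ k * (q ^ k * Z 0 0) := by gcongr
    _ ≤ (c ^ B) ^ k * (q ^ k * Z 0 0 ^ k) := by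
        gcongr
        exact le_self_pow₀ hZ0 (by omega)
    _ = (c ^ B * (q * Z 0 0)) ^ k := by ring
    _ < 1 := pow_lt_one₀ (by positivity) hcB (by omega)

theorem exists_root (h : IsPressureFamily c Z) {k : ℕ} (hk : 1 ≤ k) : ∃ r, 0 ≤ r ∧ Z k r = 1 := by
  obtain ⟨B, hB0, hB⟩ := h.exists_bound
  obtain ⟨r, hr, hZ⟩ := intermediate_value_Icc' hB0
    ((h.continuousOn k).mono Set.Icc_subset_Ici_self) ⟨(hB k hk).le, h.one_le_zero k⟩
  exact ⟨r, hr.1, hZ⟩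

theorem root_unique (h : IsPressureFamily c Z) {k : ℕ} (hk : 1 ≤ k) {r r' : ℝ} (hr : 0 ≤ r)
    (hr' : 0 ≤ r') (hZ : Z k r = 1) (hZ' : Z k r' = 1) : r = r' := by
  rcases lt_trichotomy r r' with hlt | heq | hlt
  · have := h.lt_of_lt hk hr hlt; linarith
  · exact heq
  · have := h.lt_of_lt hk hr' hlt; linarith

/-- There are no upcrossings of `[a, b]`: a root below `a` at a large level `k` makes `Z k b`
smaller than `K⁻¹`. Cutting longer words into blocks of length `k` then shows `Z l b → 0`, so the
roots are eventually below `b`. -/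
theorem exists_tendsto_root (h : IsPressureFamily c Z) {r : ℕ → ℝ}
    (hr : ∀ k, 1 ≤ k → 0 ≤ r k ∧ Z k (r k) = 1) : ∃ s, Tendsto r atTop (𝓝 s) := by
  obtain ⟨B, hB0, hB⟩ := h.exists_bound
  refine tendsto_of_no_upcrossings dense_univ ?_ ?_ ?_
  · rintro a - b - hab ⟨h1, h2⟩
    have ha : 0 ≤ a := by
      obtain ⟨k, hk, hk1⟩ := (h1.and_eventually (eventually_ge_atTop 1)).exists
      exact (hr k hk1).1.trans hk.le
    have hb : 0 ≤ b := ha.trans hab.le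
    obtain ⟨K, hK, hs⟩ := h.submul b hb
    have hlim : Tendsto (fun k : ℕ => (c ^ (b - a)) ^ k) atTop (𝓝 0) :=
      tendsto_pow_atTop_nhds_zero_of_lt_one (h.rpow_pos _).le (h.rpow_lt_one (sub_pos.2 hab))
    have hK0 : 0 < K := by linarith
    obtain ⟨k, hka, hk1, hkK⟩ := (h1.and_eventually ((eventually_ge_atTop 1).and
      (hlim.eventually_lt_const (inv_pos.2 hK0)))).exists
    have hZa : Z k a ≤ 1 := by
      rw [← (hr k hk1).2]
      exact h.le_of_le k (hr k hk1).1 hka.le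
    have hx : K * Z k b < 1 := by
      have h3 := h.decay k a b ha hab.le
      have h4 : Z k b < K⁻¹ := by
        refine (h3.trans ?_).trans_lt hkK
        exact mul_le_of_le_one_right (pow_nonneg (h.rpow_pos _).le _) hZa
      calc K * Z k b < K * K⁻¹ := by gcongr
        _ = 1 := mul_inv_cancel₀ hK0.ne'
    have hx0 : 0 ≤ K * Z k b := mul_nonneg hK0.le (h.pos k b hb).le
    set M := ∑ i ∈ Finset.range k, Z i b with hM
    have hbound : ∀ l, Z l b ≤ (K * Z k b) ^ (l / k) * M := by
      intro l
      have h3 := h.mul_add_le hb hK hs k (l / k) (l % k)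
      rw [Nat.div_add_mod'] at h3
      refine h3.trans ?_
      gcongr
      exact Finset.single_le_sum (f := fun i => Z i b) (fun i _ => (h.pos i b hb).le)
        (Finset.mem_range.2 (Nat.mod_lt _ hk1))
    have hlim2 : Tendsto (fun l => (K * Z k b) ^ (l / k) * M) atTop (𝓝 0) := by
      have h4 : Tendsto (fun l : ℕ => l / k) atTop atTop :=
        Nat.tendsto_div_const_atTop (by omega)
      simpa using ((tendsto_pow_atTop_nhds_zero_of_lt_one hx0 hx).comp h4).mul_const M
    obtain ⟨l, hl, hl1, hlZ⟩ := (h2.and_eventually ((eventually_ge_atTop 1).and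
      (hlim2.eventually_lt_const one_pos))).exists
    have := h.root_lt hb (hr l hl1).2 ((hbound l).trans_lt hlZ)
    linarith
  · exact isBoundedUnder_of_eventually_le (a := B) ((eventually_ge_atTop 1).mono fun k hk =>
      (h.root_lt hB0 (hr k hk).2 (hB k hk)).le)
  · exact isBoundedUnder_of_eventually_ge (a := 0) ((eventually_ge_atTop 1).mono fun k hk =>
      (hr k hk).1)

/-- An exponent strictly between `s` and `t` eventually exceeds the roots, so its level sums are at
most 1; the decay from it to `t` is geometric in the level. The divergence below `s` is the mirror
image. -/
theorem summable_of_gt (h : IsPressureFamily c Z) {r : ℕ → ℝ} {s t : ℝ}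
    (hr : ∀ k, 1 ≤ k → 0 ≤ r k ∧ Z k (r k) = 1) (hs : Tendsto r atTop (𝓝 s)) (hst : s < t) :
    Summable fun k => Z k t := by
  have hs0 : 0 ≤ s := ge_of_tendsto hs ((eventually_ge_atTop 1).mono fun k hk => (hr k hk).1)
  obtain ⟨t', ht', htt⟩ := exists_between hst
  have ht0 : 0 ≤ t' := hs0.trans ht'.le
  refine Summable.of_norm_bounded_eventually_nat (summable_geometric_of_lt_one (h.rpow_pos _).le
    (h.rpow_lt_one (sub_pos.2 htt))) ?_
  filter_upwards [hs.eventually_lt_const ht', eventually_ge_atTop 1] with k hk hk1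
  rw [Real.norm_of_nonneg (h.pos k t (ht0.trans htt.le)).le]
  refine (h.decay k t' t ht0 htt.le).trans ?_
  refine mul_le_of_le_one_right (pow_nonneg (h.rpow_pos _).le _) ?_
  rw [← (hr k hk1).2]
  exact h.le_of_le k (hr k hk1).1 hk.le

theorem tendsto_atTop_of_lt (h : IsPressureFamily c Z) {r : ℕ → ℝ} {s t : ℝ}
    (hr : ∀ k, 1 ≤ k → 0 ≤ r k ∧ Z k (r k) = 1) (hs : Tendsto r atTop (𝓝 s)) (ht : 0 ≤ t)
    (hst : t < s) : Tendsto (fun k => Z k t) atTop atTop := by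
  obtain ⟨t', ht', htt⟩ := exists_between hst
  have ht0 : 0 ≤ t' := ht.trans ht'.le
  have hq := h.rpow_pos (t' - t)
  refine tendsto_atTop_mono' _ ?_ (tendsto_pow_atTop_atTop_of_one_lt
    ((one_lt_inv₀ hq).2 (h.rpow_lt_one (sub_pos.2 ht'))))
  filter_upwards [hs.eventually_const_lt htt, eventually_ge_atTop 1] with k hk hk1
  have h1 : 1 ≤ Z k t' := by
    rw [← (hr k hk1).2]
    exact h.le_of_le k ht0 hk.le
  have h2 := h1.trans (h.decay k t t' ht ht'.le)
  rw [inv_pow]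
  exact (inv_le_iff_one_le_mul₀' (by positivity)).2 h2

end IsPressureFamily

/-! ### Sums over the words of a given length that extend a given word -/

/-- The sum of `f` over the extensions of the word `l` by `k` letters. -/
def levelSum {ι : Type*} [Fintype ι] (f : List ι → ℝ) : ℕ → List ι → ℝ
  | 0, l => f l
  | k + 1, l => ∑ i, levelSum f k (l ++ [i])

section levelSum

variable {ι : Type*} [Fintype ι]

theorem levelSum_eq_sum (f : List ι → ℝ) (k : ℕ) (l : List ι) :
    levelSum f k l = ∑ w : Fin k → ι, f (l ++ List.ofFn w) := by
  induction k generalizing l with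
  | zero => simp [levelSum]
  | succ k ih =>
    rw [levelSum, ← (Fin.consEquiv fun _ : Fin (k + 1) => ι).sum_comp, Fintype.sum_prod_type]
    refine Finset.sum_congr rfl fun i _ => ?_
    rw [ih]
    refine Finset.sum_congr rfl fun w _ => ?_
    simp [Fin.consEquiv, List.ofFn_succ]

theorem levelSum_mono {f g : List ι → ℝ} (h : ∀ l, f l ≤ g l) (k : ℕ) (l : List ι) :
    levelSum f k l ≤ levelSum g k l := by
  simp only [levelSum_eq_sum]
  exact Finset.sum_le_sum fun w _ => h _

theorem levelSum_const_mul (f : List ι → ℝ) (a : ℝ) (k : ℕ) (l : List ι) :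
    levelSum (fun l => a * f l) k l = a * levelSum f k l := by
  simp only [levelSum_eq_sum, Finset.mul_sum]

theorem levelSum_levelSum (f : List ι → ℝ) (j k : ℕ) (l : List ι) :
    levelSum (levelSum f k) j l = levelSum f (j + k) l := by
  induction j generalizing l with
  | zero => simp [levelSum]
  | succ j ih =>
    rw [show j + 1 + k = (j + k) + 1 by ring, levelSum, levelSum]
    exact Finset.sum_congr rfl fun i _ => ih _

theorem levelSum_le_mul {f : List ι → ℝ} {K : ℝ} (hf : ∀ l l', f (l ++ l') ≤ K * (f l * f l'))
    (k : ℕ) (l : List ι) : levelSum f k l ≤ K * (f l * levelSum f k []) := by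
  simp only [levelSum_eq_sum, Finset.mul_sum]
  exact Finset.sum_le_sum fun w _ => hf _ _

end levelSum

/-! ### Compositions of affine maps along words -/

section words

variable {n N : ℕ}

/-- The linear part of an affine automorphism, as a linear map. -/
noncomputable def linPart (T : Euc n ≃ᵃ[ℝ] Euc n) : Euc n →ₗ[ℝ] Euc n := T.linear

theorem linPart_injective (T : Euc n ≃ᵃ[ℝ] Euc n) : Function.Injective (linPart T) :=
  T.linear.injective

theorem linPart_mul (T T' : Euc n ≃ᵃ[ℝ] Euc n) : linPart (T * T') = linPart T ∘ₗ linPart T' := rfl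

theorem linPart_one : linPart (1 : Euc n ≃ᵃ[ℝ] Euc n) = LinearMap.id := rfl

theorem linPart_apply_sub (T : Euc n ≃ᵃ[ℝ] Euc n) (x y : Euc n) :
    linPart T (x - y) = T x - T y := by
  exact T.toAffineMap.linearMap_vsub x y

/-- The composition of the maps `S i` along a list of indices. -/
noncomputable def listMap (S : Fin N → (Euc n ≃ᵃ[ℝ] Euc n)) (l : List (Fin N)) :
    Euc n ≃ᵃ[ℝ] Euc n := (l.map S).prod

variable (S : Fin N → (Euc n ≃ᵃ[ℝ] Euc n))

theorem listMap_nil : listMap S [] = 1 := rfl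

theorem listMap_singleton (i : Fin N) : listMap S [i] = S i := by simp [listMap]

theorem listMap_append (l l' : List (Fin N)) :
    listMap S (l ++ l') = listMap S l * listMap S l' := by simp [listMap]

theorem listMap_append_singleton (l : List (Fin N)) (i : Fin N) :
    listMap S (l ++ [i]) = listMap S l * S i := by simp [listMap]

theorem wordMap_eq_listMap {k : ℕ} (w : Fin k → Fin N) :
    wordMap S w = listMap S (List.ofFn w) := by
  simp [wordMap, listMap, List.map_ofFn, Function.comp_def]

/-- The singular value function of the composition along a word. -/
noncomputable def wordValue (t : ℝ) (l : List (Fin N)) : ℝ :=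
  singularValueFunction t (linPart (listMap S l))

/-- The smallest singular value of the composition along a word. -/
noncomputable def wordMin (l : List (Fin N)) : ℝ :=
  (linPart (listMap S l)).singularValues (n - 1)

theorem isAffinityRoot_iff {k : ℕ} {t : ℝ} :
    IsAffinityRoot S k t ↔ 0 ≤ t ∧ levelSum (wordValue S t) k [] = 1 := by
  simp only [IsAffinityRoot, levelSum_eq_sum, wordMap_eq_listMap, List.nil_append]
  rfl

theorem wordMin_pos (hn : 1 ≤ n) (l : List (Fin N)) : 0 < wordMin S l :=
  singularValues_pos (linPart_injective _) (by omega)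

theorem wordMin_nil (hn : 1 ≤ n) : wordMin S [] = 1 := by
  refine le_antisymm (singularValues_le_of_norm_apply_le (fun x => ?_) (by omega))
    (le_singularValues_of_le_norm_apply (fun x => ?_) (by omega)) <;>
  simp [listMap_nil, linPart_one]

/-- Smallest singular values are supermultiplicative; this controls how far `wordMin` can fall when
one letter is added. -/
theorem wordMin_append_le (hn : 1 ≤ n) (l l' : List (Fin N)) :
    wordMin S l * wordMin S l' ≤ wordMin S (l ++ l') := by
  refine le_singularValues_of_le_norm_apply (fun x => ?_) (by omega)
  rw [listMap_append, linPart_mul, LinearMap.comp_apply]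
  refine le_trans ?_ (singularValue_mul_norm_le_norm_apply _ _)
  rw [mul_assoc]
  exact mul_le_mul_of_nonneg_left (singularValue_mul_norm_le_norm_apply _ _)
    (wordMin_pos S hn l).le

theorem wordValue_pos (hn : 1 ≤ n) {t : ℝ} (ht : 0 ≤ t) (l : List (Fin N)) :
    0 < wordValue S t l := singularValueFunction_pos hn (linPart_injective _) ht

theorem exists_wordValue_append_le (hn : 1 ≤ n) {t : ℝ} (ht : 0 ≤ t) :
    ∃ K, 1 ≤ K ∧ ∀ l l', wordValue S t (l ++ l') ≤ K * (wordValue S t l * wordValue S t l') := by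
  obtain ⟨K, hK, h⟩ := exists_singularValueFunction_comp_le hn ht
  refine ⟨K, hK, fun l l' => ?_⟩
  unfold wordValue
  rw [listMap_append, linPart_mul]
  exact h _ _ (linPart_injective _) (linPart_injective _)

theorem wordValue_eq (hn : 1 ≤ n) {t : ℝ} (ht : (n : ℝ) - 1 ≤ t) (htn : t ≤ n)
    (l : List (Fin N)) : wordValue S t l =
      |LinearMap.det (linPart (listMap S l))| * wordMin S l ^ (t - n) :=
  singularValueFunction_eq_abs_det_mul hn (linPart_injective _) ht htn

variable {S}

theorem exists_common_contraction (hN : 1 ≤ N) (hS : ∀ i, IsContracting (S i)) :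
    ∃ c, 0 < c ∧ c < 1 ∧ ∀ i x, ‖linPart (S i) x‖ ≤ c * ‖x‖ := by
  have : Nonempty (Fin N) := ⟨⟨0, hN⟩⟩
  choose c hc0 hc1 hc using hS
  obtain ⟨i₀, hi₀⟩ := Finite.exists_max c
  refine ⟨c i₀, hc0 _, hc1 _, fun i x => ?_⟩
  have := hc i x 0
  rw [dist_eq_norm, dist_eq_norm, ← linPart_apply_sub, sub_zero] at this
  exact this.trans (mul_le_mul_of_nonneg_right (hi₀ i) (norm_nonneg _))

theorem norm_listMap_apply_le {c : ℝ} (hc : 0 < c)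
    (hS : ∀ i x, ‖linPart (S i) x‖ ≤ c * ‖x‖) (l : List (Fin N)) (x : Euc n) :
    ‖linPart (listMap S l) x‖ ≤ c ^ l.length * ‖x‖ := by
  induction l generalizing x with
  | nil => simp [listMap_nil, linPart_one]
  | cons i l ih =>
    rw [← List.singleton_append, listMap_append, listMap_singleton, linPart_mul,
      LinearMap.comp_apply, List.length_append, List.length_singleton, pow_add, pow_one, mul_assoc]
    exact (hS i _).trans (mul_le_mul_of_nonneg_left (ih x) hc.le)

theorem singularValues_listMap_le {c : ℝ} (hc : 0 < c)
    (hS : ∀ i x, ‖linPart (S i) x‖ ≤ c * ‖x‖) (l : List (Fin N)) :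
    ∀ j < n, (linPart (listMap S l)).singularValues j ≤ c ^ l.length := fun _ hj =>
  singularValues_le_of_norm_apply_le (norm_listMap_apply_le hc hS l) hj

theorem wordValue_le (hn : 1 ≤ n) {c : ℝ} (hc : 0 < c)
    (hS : ∀ i x, ‖linPart (S i) x‖ ≤ c * ‖x‖) {s t : ℝ} (hs : 0 ≤ s) (hst : s ≤ t)
    (l : List (Fin N)) :
    wordValue S t l ≤ (c ^ (t - s)) ^ l.length * wordValue S s l := by
  have h := singularValueFunction_add_le hn (linPart_injective (listMap S l))
    (singularValues_listMap_le hc hS l) hs hst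
  rwa [← Real.rpow_natCast, ← Real.rpow_mul hc.le, mul_comm (l.length : ℝ), Real.rpow_mul hc.le,
    Real.rpow_natCast] at h

theorem wordValue_zero (l : List (Fin N)) : wordValue S 0 l = 1 := by
  simp [wordValue, singularValueFunction]

theorem isPressureFamily_levelSum (hn : 1 ≤ n) (hN : 1 ≤ N) {c : ℝ} (hc : 0 < c) (hc1 : c < 1)
    (hS : ∀ i x, ‖linPart (S i) x‖ ≤ c * ‖x‖) :
    IsPressureFamily c fun k t => levelSum (wordValue S t) k [] where
  c_pos := hc
  c_lt_one := hc1
  pos k t ht := by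
    have : Nonempty (Fin N) := ⟨⟨0, hN⟩⟩
    rw [levelSum_eq_sum]
    exact Finset.sum_pos (fun w _ => wordValue_pos S hn ht _) Finset.univ_nonempty
  continuousOn k := by
    simp only [levelSum_eq_sum]
    exact continuousOn_finsetSum _ fun w _ =>
      singularValueFunction_continuousOn hn (linPart_injective _)
  decay k s t hs hst := by
    simp only [levelSum_eq_sum, Finset.mul_sum]
    refine Finset.sum_le_sum fun w _ => ?_
    simpa using wordValue_le hn hc hS hs hst (List.ofFn w)
  one_le_zero k := by
    simp only [levelSum_eq_sum, wordValue_zero]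
    simp only [Finset.sum_const, Finset.card_univ, Fintype.card_fun, Fintype.card_fin,
      nsmul_eq_mul, mul_one]
    exact_mod_cast Nat.one_le_pow _ _ hN
  submul t ht := by
    obtain ⟨K, hK, h⟩ := exists_wordValue_append_le S hn ht
    refine ⟨K, hK, fun j k => ?_⟩
    rw [← levelSum_levelSum]
    refine (levelSum_mono (fun l => levelSum_le_mul h k l) j []).trans (le_of_eq ?_)
    rw [levelSum_const_mul]
    congr 1
    simp only [mul_comm _ (levelSum (wordValue S t) k [])]
    rw [levelSum_const_mul]

end words

/-! ### Covering numbers and volumes of thickenings -/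

theorem dist_le_of_mem_hypercube {n : ℕ} {a x : Euc n} {δ : ℝ} (hδ : 0 ≤ δ)
    (hx : x ∈ hypercube a δ) : dist x a ≤ n * δ := by
  have h1 : ∀ i, dist (x i) (a i) ≤ δ := fun i => by
    rw [Real.dist_eq, abs_le]
    constructor <;> linarith [(hx i).1, (hx i).2]
  rw [EuclideanSpace.dist_eq]
  refine Real.sqrt_le_iff.2 ⟨by positivity, ?_⟩
  calc ∑ i, dist (x i) (a i) ^ 2 ≤ ∑ _i : Fin n, δ ^ 2 := by
        refine Finset.sum_le_sum fun i _ => ?_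
        have := h1 i
        gcongr
    _ = n * δ ^ 2 := by simp
    _ ≤ (n * δ) ^ 2 := by
        rw [mul_pow]
        gcongr
        rcases Nat.eq_zero_or_pos n with rfl | hn
        · simp
        · exact le_self_pow₀ (by exact_mod_cast hn) (by norm_num)

theorem exists_closedBall_subset_hypercube {n : ℕ} (x : Euc n) (δ : ℝ) :
    ∃ a, Metric.closedBall x (δ / 2) ⊆ hypercube a δ := by
  refine ⟨WithLp.toLp 2 fun i => x i - δ / 2, fun y hy i => ?_⟩
  have h1 : ‖(y - x) i‖ ≤ δ / 2 :=
    (PiLp.norm_apply_le (y - x) i).trans (by rwa [← dist_eq_norm])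
  rw [PiLp.sub_apply, Real.norm_eq_abs, abs_le] at h1
  simp only
  constructor <;> linarith [h1.1, h1.2]

/-- A bounded set has a finite separated subset that covers it by balls. -/
theorem exists_finset_separated_cover {n : ℕ} {E : Set (Euc n)} (hE : Bornology.IsBounded E)
    {r : ℝ} (hr : 0 < r) :
    ∃ T : Finset (Euc n), (T : Set (Euc n)) ⊆ E ∧ (∀ x ∈ T, ∀ y ∈ T, x ≠ y → 2 * r < dist x y) ∧
      E ⊆ ⋃ x ∈ T, Metric.closedBall x (2 * r) := by
  lift r to NNReal using hr.le
  have hr0 : r ≠ 0 := by rintro rfl; simp at hr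
  obtain ⟨M, -, hMf, hM⟩ := Metric.exists_finite_isCover_of_isCompact_closure hr0
    hE.isCompact_closure
  have hpack : Metric.packingNumber (2 * r) E ≠ ⊤ := by
    refine ne_top_of_le_ne_top ?_ ((Metric.packingNumber_two_mul_le_externalCoveringNumber r E).trans
      hM.externalCoveringNumber_le_encard)
    exact hMf.encard_lt_top.ne
  have hfin : (Metric.maximalSeparatedSet (2 * r) E).Finite := by
    rw [← Set.encard_ne_top_iff, Metric.encard_maximalSeparatedSet hpack]
    exact hpack
  refine ⟨hfin.toFinset, by simpa using Metric.maximalSeparatedSet_subset, ?_, ?_⟩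
  · intro x hx y hy hxy
    have h1 : ((2 * r : NNReal) : ENNReal) < edist x y :=
      Metric.isSeparated_maximalSeparatedSet (hfin.mem_toFinset.1 hx) (hfin.mem_toFinset.1 hy) hxy
    rw [edist_nndist, ENNReal.coe_lt_coe, ← NNReal.coe_lt_coe] at h1
    simpa using h1
  · have := Metric.isCover_iff_subset_iUnion_closedBall.1
      (Metric.isCover_maximalSeparatedSet hpack)
    simpa using this

theorem cubeCoverNumber_le_card {n : ℕ} {E : Set (Euc n)} {δ : ℝ} {T : Finset (Euc n)}
    (hT : E ⊆ ⋃ x ∈ T, Metric.closedBall x (δ / 2)) : cubeCoverNumber δ E ≤ T.card := by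
  classical
  choose a ha using fun x : Euc n => exists_closedBall_subset_hypercube x δ
  have h : cubeCoverNumber δ E ≤ (T.image a).card :=
    Nat.sInf_le ⟨T.image a, rfl, fun y hy => ?_⟩
  · exact h.trans Finset.card_image_le
  obtain ⟨x, hx, hy⟩ := Set.mem_iUnion₂.1 (hT hy)
  exact Set.mem_iUnion₂.2 ⟨a x, Finset.mem_image_of_mem a hx, ha x hy⟩

theorem exists_cover_card_eq {n : ℕ} {E : Set (Euc n)} (hE : Bornology.IsBounded E)
    {δ : ℝ} (hδ : 0 < δ) :
    ∃ T : Finset (Euc n), T.card = cubeCoverNumber δ E ∧ E ⊆ ⋃ a ∈ T, hypercube a δ := by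
  classical
  -- Boundedness makes this set of cardinalities non-empty, so the infimum is attained and is not
  -- the default value 0.
  refine Nat.sInf_mem (s := {k | ∃ T : Finset (Euc n), T.card = k ∧ E ⊆ ⋃ a ∈ T, hypercube a δ}) ?_
  obtain ⟨T, -, -, hT⟩ := exists_finset_separated_cover hE (r := δ / 4) (by positivity)
  choose a ha using fun x : Euc n => exists_closedBall_subset_hypercube x δ
  refine ⟨_, T.image a, rfl, fun y hy => ?_⟩
  obtain ⟨x, hx, hy⟩ := Set.mem_iUnion₂.1 (hT hy)
  refine Set.mem_iUnion₂.2 ⟨a x, Finset.mem_image_of_mem a hx, ha x ?_⟩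
  rwa [show 2 * (δ / 4) = δ / 2 by ring] at hy

theorem cubeCoverNumber_pos {n : ℕ} {E : Set (Euc n)} (hE : Bornology.IsBounded E)
    (hne : E.Nonempty) {δ : ℝ} (hδ : 0 < δ) : 1 ≤ cubeCoverNumber δ E := by
  obtain ⟨T, hT, hcov⟩ := exists_cover_card_eq hE hδ
  obtain ⟨x, hx⟩ := hne
  obtain ⟨a, ha, -⟩ := Set.mem_iUnion₂.1 (hcov hx)
  rw [← hT]
  exact Finset.card_pos.2 ⟨a, ha⟩

theorem cubeCoverNumber_mono {n : ℕ} {E E' : Set (Euc n)} (hE' : Bornology.IsBounded E')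
    (h : E ⊆ E') {δ : ℝ} (hδ : 0 < δ) : cubeCoverNumber δ E ≤ cubeCoverNumber δ E' := by
  obtain ⟨T, hT, hcov⟩ := exists_cover_card_eq hE' hδ
  exact Nat.sInf_le ⟨T, hT, h.trans hcov⟩

/-- The volume of the open `r`-neighbourhood. -/
noncomputable def thickVol {n : ℕ} (r : ℝ) (E : Set (Euc n)) : ℝ :=
  volume.real (Metric.thickening r E)

theorem thickVol_nonneg {n : ℕ} (r : ℝ) (E : Set (Euc n)) : 0 ≤ thickVol r E :=
  measureReal_nonneg

theorem thickVol_mono {n : ℕ} {r r' : ℝ} {E E' : Set (Euc n)} (hE' : Bornology.IsBounded E')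
    (hr : r ≤ r') (h : E ⊆ E') : thickVol r E ≤ thickVol r' E' :=
  measureReal_mono ((Metric.thickening_subset_of_subset r h).trans (Metric.thickening_mono hr E'))
    hE'.thickening.measure_lt_top.ne

theorem exists_thickVol_le {n : ℕ} : ∃ K : ℝ, 0 < K ∧ ∀ (E : Set (Euc n)) (δ : ℝ),
    Bornology.IsBounded E → 0 < δ → thickVol δ E ≤ K * (cubeCoverNumber δ E * δ ^ n) := by
  have hb : 0 < volume.real (Metric.closedBall (0 : Euc n) 1) :=
    ENNReal.toReal_pos (Metric.measure_closedBall_pos _ _ one_pos).ne'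
      measure_closedBall_lt_top.ne
  refine ⟨(n + 1) ^ n * volume.real (Metric.closedBall (0 : Euc n) 1), by positivity,
    fun E δ hE hδ => ?_⟩
  obtain ⟨T, hT, hcov⟩ := exists_cover_card_eq hE hδ
  -- A point of a cube is within `n * δ` of its corner, and the neighbourhood adds `δ`.
  have hsub : Metric.thickening δ E ⊆ ⋃ a ∈ T, Metric.closedBall a ((n + 1) * δ) := by
    intro y hy
    obtain ⟨x, hx, hyx⟩ := Metric.mem_thickening_iff.1 hy
    obtain ⟨a, ha, hxa⟩ := Set.mem_iUnion₂.1 (hcov hx)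
    refine Set.mem_iUnion₂.2 ⟨a, ha, ?_⟩
    have := dist_le_of_mem_hypercube hδ.le hxa
    have := dist_triangle y x a
    rw [Metric.mem_closedBall]
    linarith
  have hfin : volume (⋃ a ∈ T, Metric.closedBall a ((n + 1) * δ)) ≠ ⊤ :=
    ((measure_biUnion_lt_top T.finite_toSet fun a _ => measure_closedBall_lt_top)).ne
  refine (measureReal_mono hsub hfin).trans ((measureReal_biUnion_finset_le T _).trans ?_)
  rw [Finset.sum_congr rfl fun a _ =>
    Measure.addHaar_real_closedBall' volume a (r := (n + 1) * δ) (by positivity)]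
  rw [Finset.sum_const, hT, nsmul_eq_mul, finrank_euclideanSpace_fin, mul_pow]
  exact le_of_eq (by ring)

theorem exists_cubeCoverNumber_le {n : ℕ} : ∃ K : ℝ, 0 < K ∧ ∀ (E : Set (Euc n)) (δ : ℝ),
    Bornology.IsBounded E → 0 < δ → cubeCoverNumber δ E * δ ^ n ≤ K * thickVol δ E := by
  have hb : 0 < volume.real (Metric.closedBall (0 : Euc n) 1) :=
    ENNReal.toReal_pos (Metric.measure_closedBall_pos _ _ one_pos).ne'
      measure_closedBall_lt_top.ne
  refine ⟨4 ^ n / volume.real (Metric.closedBall (0 : Euc n) 1), by positivity,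
    fun E δ hE hδ => ?_⟩
  -- Separation `δ / 2` makes the balls of radius `δ / 4` disjoint, while the covering balls of
  -- radius `δ / 2` fit into cubes of side `δ`.
  obtain ⟨T, hTE, hsep, hcov⟩ := exists_finset_separated_cover hE (r := δ / 4) (by positivity)
  rw [show 2 * (δ / 4) = δ / 2 by ring] at hcov hsep
  have hsub : (⋃ x ∈ T, Metric.closedBall x (δ / 4)) ⊆ Metric.thickening δ E := by
    intro y hy
    obtain ⟨x, hx, hyx⟩ := Set.mem_iUnion₂.1 hy
    refine Metric.mem_thickening_iff.2 ⟨x, hTE hx, ?_⟩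
    have := Metric.mem_closedBall.1 hyx
    linarith
  have hdisj : Set.PairwiseDisjoint (T : Set (Euc n)) fun x => Metric.closedBall x (δ / 4) := by
    intro x hx y hy hxy
    refine Metric.closedBall_disjoint_closedBall ?_
    have := hsep x hx y hy hxy
    linarith
  have hsum := measureReal_mono (μ := volume) hsub hE.thickening.measure_lt_top.ne
  rw [measureReal_biUnion_finset hdisj (fun x _ => measurableSet_closedBall)
    (fun x _ => measure_closedBall_lt_top.ne)] at hsum
  rw [Finset.sum_congr rfl fun a _ =>
    Measure.addHaar_real_closedBall' volume a (r := δ / 4) (by positivity)] at hsum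
  rw [Finset.sum_const, nsmul_eq_mul, finrank_euclideanSpace_fin, div_pow] at hsum
  have hcard : (cubeCoverNumber δ E : ℝ) ≤ T.card := by
    exact_mod_cast cubeCoverNumber_le_card hcov
  rw [div_mul_eq_mul_div, le_div_iff₀ hb]
  calc cubeCoverNumber δ E * δ ^ n * volume.real (Metric.closedBall (0 : Euc n) 1)
      ≤ T.card * δ ^ n * volume.real (Metric.closedBall (0 : Euc n) 1) := by gcongr
    _ = 4 ^ n * (T.card * (δ ^ n / 4 ^ n * volume.real (Metric.closedBall (0 : Euc n) 1))) := by
        field_simp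
    _ ≤ 4 ^ n * thickVol δ E := by
        unfold thickVol
        gcongr

/-! ### Images under affine maps -/

theorem measureReal_image_affineEquiv {n : ℕ} (T : Euc n ≃ᵃ[ℝ] Euc n) (E : Set (Euc n)) :
    volume.real (T '' E) = |LinearMap.det (linPart T)| * volume.real E := by
  have h : T '' E = (fun y => y + T 0) '' (linPart T '' E) := by
    rw [Set.image_image]
    refine Set.image_congr fun x _ => ?_
    have := linPart_apply_sub T x 0
    rw [sub_zero] at this
    rw [this, sub_add_cancel]
  rw [h, measureReal_def, measureReal_def, Set.image_add_right, measure_preimage_add_right,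
    Measure.addHaar_image_linearMap, ENNReal.toReal_mul, ENNReal.toReal_ofReal (abs_nonneg _)]

theorem mul_dist_le_dist_affineEquiv {n : ℕ} (T : Euc n ≃ᵃ[ℝ] Euc n) (x y : Euc n) :
    (linPart T).singularValues (n - 1) * dist x y ≤ dist (T x) (T y) := by
  rw [dist_eq_norm, dist_eq_norm, ← linPart_apply_sub]
  exact singularValue_mul_norm_le_norm_apply _ _

theorem thickening_image_subset {n : ℕ} (hn : 1 ≤ n) (T : Euc n ≃ᵃ[ℝ] Euc n) (E : Set (Euc n))
    (δ : ℝ) : Metric.thickening δ (T '' E) ⊆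
      T '' Metric.thickening (δ / (linPart T).singularValues (n - 1)) E := by
  intro y hy
  obtain ⟨_, ⟨x, hx, rfl⟩, hyx⟩ := Metric.mem_thickening_iff.1 hy
  refine ⟨T.symm y, Metric.mem_thickening_iff.2 ⟨x, hx, ?_⟩, by simp⟩
  rw [lt_div_iff₀' (singularValues_pos (linPart_injective T) (by omega))]
  refine (mul_dist_le_dist_affineEquiv T _ _).trans_lt ?_
  simpa using hyx

theorem thickVol_image_le {n : ℕ} (hn : 1 ≤ n) (T : Euc n ≃ᵃ[ℝ] Euc n) {E : Set (Euc n)}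
    (hE : Bornology.IsBounded E) (δ : ℝ) : thickVol δ (T '' E) ≤
      |LinearMap.det (linPart T)| * thickVol (δ / (linPart T).singularValues (n - 1)) E := by
  unfold thickVol
  rw [← measureReal_image_affineEquiv]
  refine measureReal_mono (thickening_image_subset hn T E δ) ?_
  have hb := hE.thickening (δ := δ / (linPart T).singularValues (n - 1))
  have hc : Continuous T := T.continuous_of_finiteDimensional
  exact ((hb.isCompact_closure.image hc).isBounded.subset
    (Set.image_mono subset_closure)).measure_lt_top.ne

/-! ### Sweeping a set along a direction, and Fubini. -/

/-- The union of the translates of `C` by `s • v`, for `|s| ≤ r`. -/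
def sweep {n : ℕ} (C : Set (Euc n)) (v : Euc n) (r : ℝ) : Set (Euc n) :=
  (fun p : Euc n × ℝ => p.1 + p.2 • v) '' (C ×ˢ Set.Icc (-r) r)

theorem isCompact_sweep {n : ℕ} {C : Set (Euc n)} (hC : IsCompact C) (v : Euc n) (r : ℝ) :
    IsCompact (sweep C v r) :=
  (hC.prod isCompact_Icc).image (by fun_prop)

theorem sweep_subset_thickening {n : ℕ} (C : Set (Euc n)) {v : Euc n} (hv : ‖v‖ = 1) {r r' : ℝ}
    (h : r < r') : sweep C v r ⊆ Metric.thickening r' C := by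
  rintro _ ⟨⟨x, s⟩, ⟨hx, hs⟩, rfl⟩
  refine Metric.mem_thickening_iff.2 ⟨x, hx, ?_⟩
  rw [dist_eq_norm, add_sub_cancel_left, norm_smul, hv, mul_one]
  exact (abs_le.2 hs).trans_lt h

/-- For `v` the last right singular vector, `T` shrinks lengths along `v` exactly by `α_n`. A sweep
of fixed size thus stays within a distance of order `α_n` of `T '' C`, yet its volume only changes
by the determinant. -/
theorem exists_image_sweep_subset_thickening {n : ℕ} (hn : 1 ≤ n) (T : Euc n ≃ᵃ[ℝ] Euc n) :
    ∃ v : Euc n, ‖v‖ = 1 ∧ ∀ (C : Set (Euc n)) (r r' : ℝ),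
      r * (linPart T).singularValues (n - 1) < r' →
      T '' sweep C v r ⊆ Metric.thickening r' (T '' C) := by
  obtain ⟨v, hv, hT⟩ := exists_norm_one_norm_apply_eq_singularValue (linPart T)
    (show n - 1 < n by omega)
  refine ⟨v, hv, ?_⟩
  rintro C r r' h _ ⟨_, ⟨⟨x, s⟩, ⟨hx, hs⟩, rfl⟩, rfl⟩
  refine Metric.mem_thickening_iff.2 ⟨T x, ⟨x, hx, rfl⟩, ?_⟩
  rw [dist_eq_norm, ← linPart_apply_sub, add_sub_cancel_left, map_smul, norm_smul, hT]
  refine lt_of_le_of_lt ?_ h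
  exact mul_le_mul_of_nonneg_right (abs_le.2 hs) ((linPart T).singularValues_nonneg _)

/-- The isometry `(p, s) ↦ p + s • v` onto `E`, for a unit vector `v` and `p` orthogonal to `v`. -/
theorem measurePreserving_orthogonal_add_smul {n : ℕ} {v : Euc n}
    (hv : ‖v‖ = 1) : MeasurePreserving
      (fun p : (Submodule.span ℝ {v})ᗮ × ℝ => (p.1 : Euc n) + p.2 • v) := by
  have hv0 : v ≠ 0 := by rintro rfl; simp at hv
  let L : WithLp 2 ((Submodule.span ℝ {v})ᗮ × ℝ) →ₗ[ℝ] Euc n :=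
    { toFun := fun p => (p.fst : Euc n) + p.snd • v
      map_add' := fun p q => by simp [add_smul]; abel
      map_smul' := fun c p => by simp [smul_smul] }
  have hiso : ∀ p, ‖L p‖ = ‖p‖ := by
    intro p
    have horth : inner ℝ (p.fst : Euc n) (p.snd • v) = 0 := by
      rw [inner_smul_right, Submodule.mem_orthogonal_singleton_iff_inner_left.1 p.fst.2, mul_zero]
    have h1 := norm_add_sq_eq_norm_sq_add_norm_sq_of_inner_eq_zero _ _ horth
    have h2 := WithLp.prod_norm_sq_eq_of_L2 p
    rw [norm_smul, hv, mul_one] at h1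
    refine (sq_eq_sq₀ (norm_nonneg _) (norm_nonneg _)).1 ?_
    rw [h2, sq, sq, sq]
    exact h1
  have hrank : Module.finrank ℝ (WithLp 2 ((Submodule.span ℝ {v})ᗮ × ℝ)) =
      Module.finrank ℝ (Euc n) := by
    have h1 := (Submodule.span ℝ {v}).finrank_add_finrank_orthogonal
    rw [finrank_span_singleton hv0] at h1
    rw [(WithLp.linearEquiv 2 ℝ ((Submodule.span ℝ {v})ᗮ × ℝ)).finrank_eq, Module.finrank_prod,
      Module.finrank_self, ← h1, add_comm]
  let e := (LinearIsometry.mk L hiso).toLinearIsometryEquiv hrank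
  exact e.measurePreserving.comp (WithLp.volume_preserving_toLp _ _)

/-- A line parallel to `v` over a point of the projection meets `C`, so it meets the sweep in a
segment of length at least `2 * r`. Integrate over the projection. -/
theorem measure_projection_mul_le_measure_sweep {n : ℕ} {C : Set (Euc n)}
    (hC : IsCompact C) {v : Euc n} (hv : ‖v‖ = 1) (r : ℝ) :
    volume ((Submodule.span ℝ {v})ᗮ.orthogonalProjectionOnto '' C) * ENNReal.ofReal (2 * r) ≤
      volume (sweep C v r) := by
  set V := (Submodule.span ℝ {v})ᗮ
  have hsw := (isCompact_sweep hC v r).measurableSet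
  have hmp := measurePreserving_orthogonal_add_smul hv
  rw [← hmp.measure_preimage hsw.nullMeasurableSet, Measure.volume_eq_prod,
    Measure.prod_apply (hmp.measurable hsw)]
  have hP : MeasurableSet (V.orthogonalProjectionOnto '' C) :=
    (hC.image V.orthogonalProjectionOnto.continuous).measurableSet
  rw [mul_comm, ← setLIntegral_const]
  refine (setLIntegral_mono' hP ?_).trans (setLIntegral_le_lintegral _ _)
  rintro _ ⟨x, hx, rfl⟩
  have hdec : ∃ s₀ : ℝ, x = (V.orthogonalProjectionOnto x : Euc n) + s₀ • v := by
    have h1 : x - V.orthogonalProjectionOnto x ∈ Vᗮ := V.sub_starProjection_mem_orthogonal x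
    have hVV : Vᗮ = Submodule.span ℝ {v} := Submodule.orthogonal_orthogonal _
    rw [hVV] at h1
    obtain ⟨s, hs⟩ := Submodule.mem_span_singleton.1 h1
    exact ⟨s, by rw [hs]; abel⟩
  obtain ⟨s₀, hs₀⟩ := hdec
  have hsub : Set.Icc (s₀ - r) (s₀ + r) ⊆
      Prod.mk (V.orthogonalProjectionOnto x) ⁻¹'
        ((fun p : V × ℝ => (p.1 : Euc n) + p.2 • v) ⁻¹' sweep C v r) := by
    intro s hs
    refine ⟨(x, s - s₀), ⟨hx, ?_, ?_⟩, ?_⟩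
    · simp only; linarith [hs.1]
    · simp only; linarith [hs.2]
    · simp only
      nth_rw 1 [hs₀]
      rw [sub_smul]
      abel
  refine le_trans (le_of_eq ?_) (measure_mono hsub)
  rw [Real.volume_Icc]
  congr 1
  ring

theorem exists_mul_le_measure_sweep {n : ℕ} (hn : 1 ≤ n) {C : Set (Euc n)}
    (hC : IsCompact C) (hproj : 0 < infHyperplaneProjection C) :
    ∃ κ : ℝ, 0 < κ ∧ ∀ v : Euc n, ‖v‖ = 1 → ∀ r, 0 ≤ r → κ * r ≤ volume.real (sweep C v r) := by
  -- Truncating at 1 ensures finiteness before passing to real numbers.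
  set m := min (infHyperplaneProjection C) 1 with hm
  have hm0 : 0 < m := lt_min hproj one_pos
  have hmt : m ≠ ⊤ := ne_top_of_le_ne_top ENNReal.one_ne_top (min_le_right _ _)
  refine ⟨2 * m.toReal, by have := ENNReal.toReal_pos hm0.ne' hmt; positivity,
    fun v hv r hr => ?_⟩
  have hv0 : v ≠ 0 := by rintro rfl; simp at hv
  have hrank : Module.finrank ℝ (Submodule.span ℝ {v})ᗮ = n - 1 := by
    have h1 := (Submodule.span ℝ {v}).finrank_add_finrank_orthogonal
    rw [finrank_span_singleton hv0, finrank_euclideanSpace_fin] at h1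
    omega
  have h1 : m ≤ volume ((Submodule.span ℝ {v})ᗮ.orthogonalProjectionOnto '' C) :=
    (min_le_left _ _).trans (iInf_le (fun V : {V : Submodule ℝ (Euc n) //
      Module.finrank ℝ V = n - 1} => (volume : Measure V.1)
        (V.1.orthogonalProjectionOnto '' C)) ⟨_, hrank⟩)
  have h2 := (mul_le_mul_left h1 _).trans (measure_projection_mul_le_measure_sweep hC hv r)
  have h3 := ENNReal.toReal_mono (isCompact_sweep hC v r).measure_lt_top.ne h2
  rw [ENNReal.toReal_mul, ENNReal.toReal_ofReal (by positivity)] at h3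
  rw [measureReal_def]
  linarith

/-! ### Sums over stopped words -/

section stopSum

variable {ι : Type*} [Fintype ι]

theorem sum_range_levelSum_succ (f : List ι → ℝ) (m : ℕ) (l : List ι) :
    ∑ j ∈ Finset.range (m + 2), levelSum f j l =
      f l + ∑ i, ∑ j ∈ Finset.range (m + 1), levelSum f j (l ++ [i]) := by
  rw [Finset.sum_range_succ', Finset.sum_comm, add_comm]
  rfl

open Classical in
/-- The sum of `f` over the extensions of `l` that are stopped as soon as `p` holds, and after
at most `m` additional letters. -/
noncomputable def stopSum (f : List ι → ℝ) (p : List ι → Prop) : ℕ → List ι → ℝ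
  | 0, l => f l
  | m + 1, l => if p l then f l else ∑ i, stopSum f p m (l ++ [i])

/-- Sums over stopped words are bounded below if the level sums of a submultiplicative function
are unbounded. -/
theorem one_le_mul_stopSum {f : List ι → ℝ} (hf0 : ∀ l, 0 < f l) {K : ℝ} (hK : 1 ≤ K)
    (hf : ∀ l l', f (l ++ l') ≤ K * (f l * f l'))
    (hZ : Tendsto (fun k => levelSum f k []) atTop atTop) (p : List ι → Prop) (m : ℕ) :
    1 ≤ K * stopSum f p m [] := by
  -- At a record level `k` every shorter level sum is at most the `k`-th one. Splitting the words of
  -- length `k` at their stopped prefixes `l` bounds each group by `K * f l` times the level sum,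
  -- which then cancels.
  obtain ⟨k, hmk, hk⟩ := Filter.high_scores hZ (m + 1)
  have hk' : ∀ j ≤ k, levelSum f j [] ≤ levelSum f k [] := fun j hj => by
    rcases hj.lt_or_eq with h | rfl
    · exact (hk j h).le
    · exact le_rfl
  have hZk : 0 < levelSum f k [] :=
    (show 0 < levelSum f 0 [] from hf0 []).trans (hk 0 (by omega))
  have hleaf : ∀ l k', k' ≤ k → levelSum f k' l ≤ K * f l * levelSum f k [] := by
    intro l k' hk1
    refine (levelSum_le_mul hf k' l).trans ?_
    rw [mul_assoc]
    have := (hf0 l).le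
    gcongr
    exact hk' k' hk1
  have key : ∀ m l k', m ≤ k' → k' ≤ k →
      levelSum f k' l ≤ K * stopSum f p m l * levelSum f k [] := by
    intro m
    induction m with
    | zero => exact fun l k' _ hk1 => hleaf l k' hk1
    | succ m ih =>
      intro l k' hm hk1
      rw [stopSum]
      split_ifs with hp
      · exact hleaf l k' hk1
      · obtain ⟨k', rfl⟩ : ∃ k'', k' = k'' + 1 := ⟨k' - 1, by omega⟩
        rw [levelSum, Finset.mul_sum, Finset.sum_mul]
        exact Finset.sum_le_sum fun i _ => ih _ k' (by omega) (by omega)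
  have := key m [] k (by omega) le_rfl
  exact le_of_mul_le_mul_right (by rwa [one_mul]) hZk

end stopSum

/-! ### Volume estimates for the attractor over the tree of words. -/

section attractor

variable {n N : ℕ} {S : Fin N → (Euc n ≃ᵃ[ℝ] Euc n)} {C F : Set (Euc n)}

theorem IsInhomogeneousAttractor.subset (hF : IsInhomogeneousAttractor S C F) : C ⊆ F := by
  rw [hF.eq_union]
  exact Set.subset_union_right

theorem IsInhomogeneousAttractor.listMap_image_subset (hF : IsInhomogeneousAttractor S C F)
    (l : List (Fin N)) : listMap S l '' F ⊆ F := by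
  induction l with
  | nil => simp [listMap_nil]
  | cons i l ih =>
    rw [← List.singleton_append, listMap_append, listMap_singleton, AffineEquiv.coe_mul,
      Set.image_comp]
    refine (Set.image_mono ih).trans ?_
    conv_rhs => rw [hF.eq_union]
    exact (Set.subset_iUnion (fun i => S i '' F) i).trans Set.subset_union_left

theorem IsInhomogeneousAttractor.listMap_image_eq (hF : IsInhomogeneousAttractor S C F)
    (l : List (Fin N)) :
    listMap S l '' F = listMap S l '' C ∪ ⋃ i, listMap S (l ++ [i]) '' F := by
  conv_lhs => rw [hF.eq_union]
  rw [Set.image_union, Set.image_iUnion, Set.union_comm]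
  simp only [listMap_append_singleton, AffineEquiv.coe_mul, Set.image_comp]

theorem abs_det_eq_wordValue_mul (hn : 1 ≤ n) {t : ℝ} (ht : (n : ℝ) - 1 ≤ t) (htn : t ≤ n)
    (l : List (Fin N)) : |LinearMap.det (linPart (listMap S l))| =
      wordValue S t l * wordMin S l ^ ((n : ℝ) - t) := by
  rw [wordValue_eq S hn ht htn, mul_assoc, ← Real.rpow_add (wordMin_pos S hn l)]
  simp

theorem wordMin_le (hn : 1 ≤ n) {c : ℝ} (hc : 0 < c) (hS : ∀ i x, ‖linPart (S i) x‖ ≤ c * ‖x‖)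
    (l : List (Fin N)) : wordMin S l ≤ c ^ l.length :=
  singularValues_listMap_le hc hS l _ (by omega)

/-- One letter costs at most the factor `a`, so a word that has just dropped below `δ` still has
`wordMin` at least `a * δ`. -/
theorem mul_le_wordMin_append (hn : 1 ≤ n) {a δ : ℝ} (ha : ∀ i, a ≤ wordMin S [i]) (hδ : 0 ≤ δ)
    (ha0 : 0 ≤ a) {l : List (Fin N)} (hl : δ ≤ wordMin S l) (i : Fin N) :
    a * δ ≤ wordMin S (l ++ [i]) := by
  refine le_trans ?_ (wordMin_append_le S hn l [i])
  rw [mul_comm]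
  exact mul_le_mul hl (ha i) ha0 (hδ.trans hl)

theorem thickVol_union_le {E E' : Set (Euc n)} {r : ℝ} :
    thickVol r (E ∪ E') ≤ thickVol r E + thickVol r E' := by
  unfold thickVol
  rw [Metric.thickening_union]
  exact measureReal_union_le _ _

theorem thickVol_iUnion_le {ι : Type*} [Fintype ι] {E : ι → Set (Euc n)} {r : ℝ} :
    thickVol r (⋃ i, E i) ≤ ∑ i, thickVol r (E i) := by
  unfold thickVol
  rw [Metric.thickening_iUnion]
  exact measureReal_iUnion_fintype_le _

/-- The upper volume bound for an inhomogeneous self-affine set. -/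
theorem exists_thickVol_attractor_le (hn : 1 ≤ n) (hF : IsInhomogeneousAttractor S C F)
    {c : ℝ} (hc : 0 < c) (hc1 : c < 1) (hS : ∀ i x, ‖linPart (S i) x‖ ≤ c * ‖x‖)
    {a : ℝ} (ha0 : 0 < a) (ha1 : a < 1) (ha : ∀ i, a ≤ wordMin S [i])
    {t : ℝ} (ht : (n : ℝ) - 1 ≤ t) (htn : t ≤ n)
    (hsum : Summable fun k => levelSum (wordValue S t) k []) {K : ℝ}
    (hK : ∀ ρ, 0 < ρ → ρ ≤ 1 → thickVol ρ C ≤ K * ρ ^ ((n : ℝ) - t)) :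
    ∃ K', 0 < K' ∧ ∀ δ, 0 < δ → δ ≤ 1 → thickVol δ F ≤ K' * δ ^ ((n : ℝ) - t) := by
  have hn1 : (1 : ℝ) ≤ n := by exact_mod_cast hn
  have ht0 : 0 ≤ t := by linarith
  have hFb := hF.isCompact.isBounded
  have hCb := hFb.subset hF.subset
  have hK0 : 0 ≤ K := by
    have := (thickVol_nonneg 1 C).trans (hK 1 one_pos le_rfl)
    simpa using this
  -- `K` serves the pieces `S_l(C)`; `thickVol a⁻¹ F` serves the stopped pieces `S_l(F)`, for which
  -- `δ / wordMin S l ≤ a⁻¹`.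
  set M := K + thickVol a⁻¹ F with hM
  have hM0 : 0 ≤ M := add_nonneg hK0 (thickVol_nonneg _ _)
  have hpos : ∀ k l, 0 ≤ levelSum (wordValue S t) k l := fun k l => by
    rw [levelSum_eq_sum]
    exact Finset.sum_nonneg fun w _ => (wordValue_pos S hn ht0 _).le
  -- Here `m` is the number of letters still allowed; the condition on `c ^ (l.length + m)` forces
  -- the stopping to occur before they run out.
  have key : ∀ δ, 0 < δ → ∀ m l, a * δ ≤ wordMin S l → c ^ (l.length + m) < δ →
      thickVol δ (listMap S l '' F) ≤
        M * δ ^ ((n : ℝ) - t) * ∑ j ∈ Finset.range (m + 1), levelSum (wordValue S t) j l := by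
    intro δ hδ
    have hleaf : ∀ m l, a * δ ≤ wordMin S l → wordMin S l < δ →
      thickVol δ (listMap S l '' F) ≤
        M * δ ^ ((n : ℝ) - t) * ∑ j ∈ Finset.range (m + 1), levelSum (wordValue S t) j l := by
      intro m l hl hlδ
      have hσ := wordMin_pos S hn l
      have h1 := thickVol_image_le hn (listMap S l) hFb δ
      rw [abs_det_eq_wordValue_mul hn ht htn] at h1
      change _ ≤ _ * thickVol (δ / wordMin S l) F at h1
      have h2 : thickVol (δ / wordMin S l) F ≤ M := by
        refine (thickVol_mono hFb ?_ subset_rfl).trans (le_add_of_nonneg_left hK0)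
        rw [div_le_iff₀ hσ, ← div_eq_inv_mul, le_div_iff₀ ha0]
        linarith
      have h3 : wordMin S l ^ ((n : ℝ) - t) ≤ δ ^ ((n : ℝ) - t) :=
        Real.rpow_le_rpow hσ.le hlδ.le (by linarith)
      have h4 : wordValue S t l ≤
          ∑ j ∈ Finset.range (m + 1), levelSum (wordValue S t) j l :=
        Finset.single_le_sum (f := fun j => levelSum (wordValue S t) j l) (fun j _ => hpos j l)
          (Finset.mem_range.2 (Nat.succ_pos m))
      have h5 := (wordValue_pos S hn ht0 l).le
      have h7 := thickVol_nonneg (δ / wordMin S l) F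
      have h6 : 0 ≤ wordMin S l ^ ((n : ℝ) - t) := by positivity
      calc _ ≤ _ := h1
        _ ≤ wordValue S t l * δ ^ ((n : ℝ) - t) * M := by gcongr
        _ ≤ (∑ j ∈ Finset.range (m + 1), levelSum (wordValue S t) j l) *
            δ ^ ((n : ℝ) - t) * M := by gcongr
        _ = _ := by ring
    intro m
    induction m with
    | zero =>
      exact fun l hl hlc => hleaf 0 l hl ((wordMin_le hn hc hS l).trans_lt hlc)
    | succ m ih =>
      intro l hl hlc
      by_cases hlδ : wordMin S l < δ
      · exact hleaf _ l hl hlδ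
      push Not at hlδ
      have hσ := wordMin_pos S hn l
      rw [sum_range_levelSum_succ, hF.listMap_image_eq, mul_add, Finset.mul_sum]
      refine thickVol_union_le.trans (add_le_add ?_ (thickVol_iUnion_le.trans
        (Finset.sum_le_sum fun i _ => ih (l ++ [i]) (mul_le_wordMin_append hn ha hδ.le ha0.le hlδ i)
          ?_)))
      · have h1 := thickVol_image_le hn (listMap S l) hCb δ
        rw [wordValue_eq S hn ht htn]
        change _ ≤ _ * thickVol (δ / wordMin S l) C at h1
        -- The word is not stopped, so the rescaled radius is at most 1 and the bound for `C`
        -- applies.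
        have h2 := hK (δ / wordMin S l) (by positivity) ((div_le_one hσ).2 hlδ)
        have h3 : (δ / wordMin S l) ^ ((n : ℝ) - t) =
            δ ^ ((n : ℝ) - t) * wordMin S l ^ (t - n) := by
          rw [Real.div_rpow hδ.le hσ.le, div_eq_mul_inv, ← Real.rpow_neg hσ.le, neg_sub]
        rw [h3] at h2
        have hKM : K ≤ M := le_add_of_nonneg_right (thickVol_nonneg _ _)
        have h4 : 0 ≤ wordMin S l ^ (t - n) := by positivity
        calc _ ≤ _ := h1
          _ ≤ |LinearMap.det (linPart (listMap S l))| *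
              (K * (δ ^ ((n : ℝ) - t) * wordMin S l ^ (t - n))) := by gcongr
          _ ≤ |LinearMap.det (linPart (listMap S l))| *
              (M * (δ ^ ((n : ℝ) - t) * wordMin S l ^ (t - n))) := by gcongr
          _ = _ := by ring
      · rw [List.length_append, List.length_singleton]
        rwa [show l.length + 1 + m = l.length + (m + 1) by ring]
  refine ⟨M * (∑' k, levelSum (wordValue S t) k []) + 1, ?_, fun δ hδ hδ1 => ?_⟩
  · have : 0 ≤ ∑' k, levelSum (wordValue S t) k [] := tsum_nonneg fun k => hpos k []
    positivity
  · obtain ⟨m, hm⟩ := exists_pow_lt_of_lt_one hδ hc1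
    have h1 := key δ hδ m [] (by rw [wordMin_nil S hn]; nlinarith) (by simpa using hm)
    rw [listMap_nil, AffineEquiv.coe_one, Set.image_id] at h1
    have h2 := hsum.sum_le_tsum (Finset.range (m + 1)) fun k _ => hpos k []
    have h3 : 0 ≤ δ ^ ((n : ℝ) - t) := by positivity
    calc _ ≤ _ := h1
      _ ≤ M * δ ^ ((n : ℝ) - t) * ∑' k, levelSum (wordValue S t) k [] := by gcongr
      _ ≤ _ := by nlinarith

/-- The part of the neighbourhood of `F` in the image of `U` along a word is superadditive. -/
theorem sum_measureReal_inter_listMap_le {U : Set (Euc n)} (hU : IsOpen U)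
    (hUS : ∀ i, S i '' U ⊆ U) (hdisj : ∀ i j, i ≠ j → S i '' U ∩ S j '' U = ∅)
    (hF : Bornology.IsBounded F) (r : ℝ) (l : List (Fin N)) :
    ∑ i, volume.real (Metric.thickening r F ∩ listMap S (l ++ [i]) '' U) ≤
      volume.real (Metric.thickening r F ∩ listMap S l '' U) := by
  have hopen : ∀ l : List (Fin N), IsOpen (listMap S l '' U) := fun l =>
    (AffineEquiv.toContinuousAffineEquiv (listMap S l)).toHomeomorph.isOpenMap U hU
  have hfin : ∀ A : Set (Euc n), volume (Metric.thickening r F ∩ A) ≠ ⊤ := fun A =>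
    (hF.thickening.subset Set.inter_subset_left).measure_lt_top.ne
  rw [← measureReal_iUnion_fintype (h' := fun i => hfin _)]
  · refine measureReal_mono (Set.iUnion_subset fun i => Set.inter_subset_inter_right _ ?_) (hfin _)
    rw [listMap_append_singleton, AffineEquiv.coe_mul, Set.image_comp]
    exact Set.image_mono (hUS i)
  · intro i j hij
    refine Disjoint.mono Set.inter_subset_right Set.inter_subset_right ?_
    simp only [listMap_append_singleton, AffineEquiv.coe_mul, Set.image_comp]
    exact Set.disjoint_image_of_injective (listMap S l).injective
      (Set.disjoint_iff_inter_eq_empty.2 (hdisj i j hij))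
  · exact fun i => Metric.isOpen_thickening.measurableSet.inter (hopen _).measurableSet

/-- Since `φ^n = |det|`, the level sums measure the total volume of the images of a ball in `U`,
which are disjoint and stay in a bounded neighbourhood of `F`. The neighbourhood matters because `U`
may be unbounded. This yields `s ≤ n`. -/
theorem exists_levelSum_natCast_le (hn : 1 ≤ n) (hF : IsInhomogeneousAttractor S C F)
    {c : ℝ} (hc : 0 < c) (hc1 : c < 1) (hS : ∀ i x, ‖linPart (S i) x‖ ≤ c * ‖x‖)
    (hC : C.Nonempty) (hosc : CondensationOSC S C) :
    ∃ B, ∀ k, levelSum (wordValue S n) k [] ≤ B := by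
  obtain ⟨U, hU, hCU, hUS, hdisj⟩ := hosc
  obtain ⟨x₀, hx₀⟩ := hC
  obtain ⟨ε, hε, hball⟩ := Metric.isOpen_iff.1 hU x₀ (hCU hx₀).1
  have hv : 0 < volume.real (Metric.ball x₀ ε) :=
    ENNReal.toReal_pos (Metric.measure_ball_pos _ _ hε).ne' measure_ball_lt_top.ne
  have hFb := hF.isCompact.isBounded
  have key : ∀ k l, volume.real (Metric.ball x₀ ε) * levelSum (wordValue S n) k l ≤
      volume.real (Metric.thickening ε F ∩ listMap S l '' U) := by
    intro k
    induction k with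
    | zero =>
      intro l
      have h1 := abs_det_eq_wordValue_mul (S := S) hn (t := n) (by linarith) le_rfl l
      rw [sub_self, Real.rpow_zero, mul_one] at h1
      rw [levelSum, ← h1, mul_comm, ← measureReal_image_affineEquiv]
      refine measureReal_mono (Set.subset_inter ?_ (Set.image_mono hball))
        (hFb.thickening.subset Set.inter_subset_left).measure_lt_top.ne
      rintro _ ⟨x, hx, rfl⟩
      refine Metric.mem_thickening_iff.2
        ⟨listMap S l x₀, hF.listMap_image_subset l ⟨x₀, hF.subset hx₀, rfl⟩, ?_⟩
      rw [dist_eq_norm, ← linPart_apply_sub]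
      refine (norm_listMap_apply_le hc hS l _).trans_lt ?_
      rw [← dist_eq_norm]
      exact (mul_le_of_le_one_left dist_nonneg (pow_le_one₀ hc.le hc1.le)).trans_lt hx
    | succ k ih =>
      intro l
      rw [levelSum, Finset.mul_sum]
      exact (Finset.sum_le_sum fun i _ => ih _).trans
        (sum_measureReal_inter_listMap_le hU hUS hdisj hFb ε l)
  refine ⟨volume.real (Metric.thickening ε F ∩ listMap S [] '' U) /
    volume.real (Metric.ball x₀ ε), fun k => ?_⟩
  rw [le_div_iff₀' hv]
  exact key k []

/-- The lower volume bound for an inhomogeneous self-affine set. -/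
theorem exists_le_thickVol_attractor (hn : 1 ≤ n) (hF : IsInhomogeneousAttractor S C F)
    (hC : IsCompact C) {c : ℝ} (hc : 0 < c) (hc1 : c < 1)
    (hS : ∀ i x, ‖linPart (S i) x‖ ≤ c * ‖x‖) {a : ℝ} (ha0 : 0 < a) (ha1 : a < 1)
    (ha : ∀ i, a ≤ wordMin S [i]) (hosc : CondensationOSC S C) {κ : ℝ} (hκ : 0 < κ)
    (hsweep : ∀ v : Euc n, ‖v‖ = 1 → ∀ r, 0 ≤ r → κ * r ≤ volume.real (sweep C v r))
    {t : ℝ} (ht : (n : ℝ) - 1 ≤ t) (htn : t ≤ n)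
    (hZ : Tendsto (fun k => levelSum (wordValue S t) k []) atTop atTop) :
    ∃ ρ κ', 0 < ρ ∧ 0 < κ' ∧
      ∀ δ, 0 < δ → δ ≤ 1 → κ' * δ ^ ((n : ℝ) - t) ≤ thickVol (ρ * δ) F := by
  obtain ⟨U, hU, hCU, hUS, hdisj⟩ := hosc
  have hn1 : (1 : ℝ) ≤ n := by exact_mod_cast hn
  have ht0 : 0 ≤ t := by linarith
  have hFb := hF.isCompact.isBounded
  obtain ⟨ρ₀, hρ₀, hthick⟩ := hC.exists_thickening_subset_open hU fun x hx => (hCU hx).1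
  -- Halving keeps the closed sweep of size `ρ` inside the open `ρ₀`-neighbourhood, hence inside
  -- `U`.
  set ρ := ρ₀ / 2 with hρ
  have hρ0 : 0 < ρ := by positivity
  obtain ⟨K, hK, hsub⟩ := exists_wordValue_append_le S hn ht0
  -- `κ * ρ` is the volume of a sweep; the power of `a` is lost because stopped words only satisfy
  -- `a * δ ≤ wordMin S l`.
  set M := κ * ρ * a ^ ((n : ℝ) - t) with hM
  have hM0 : 0 < M := by positivity
  have key : ∀ δ, 0 < δ → ∀ m l, a * δ ≤ wordMin S l → c ^ (l.length + m) < δ →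
      M * δ ^ ((n : ℝ) - t) * stopSum (wordValue S t) (fun l => wordMin S l < δ) m l ≤
        volume.real (Metric.thickening (ρ * δ) F ∩ listMap S l '' U) := by
    intro δ hδ
    have hleaf : ∀ l, a * δ ≤ wordMin S l → wordMin S l < δ →
        M * δ ^ ((n : ℝ) - t) * wordValue S t l ≤
          volume.real (Metric.thickening (ρ * δ) F ∩ listMap S l '' U) := by
      intro l hl hlδ
      obtain ⟨v, hv, himg⟩ := exists_image_sweep_subset_thickening hn (listMap S l)
      have h1 : listMap S l '' sweep C v ρ ⊆
          Metric.thickening (ρ * δ) F ∩ listMap S l '' U := by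
        refine Set.subset_inter ((himg C ρ (ρ * δ) (mul_lt_mul_of_pos_left hlδ hρ0)).trans
          (Metric.thickening_subset_of_subset _ ?_)) (Set.image_mono ?_)
        · exact (Set.image_mono hF.subset).trans (hF.listMap_image_subset l)
        · exact (sweep_subset_thickening C hv (by rw [hρ]; linarith)).trans hthick
      have h2 := measureReal_mono (μ := volume) h1
        (hFb.thickening.subset Set.inter_subset_left).measure_lt_top.ne
      refine le_trans ?_ h2
      rw [measureReal_image_affineEquiv, abs_det_eq_wordValue_mul hn ht htn]
      have h3 := hsweep v hv ρ hρ0.le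
      have h4 : (a * δ) ^ ((n : ℝ) - t) ≤ wordMin S l ^ ((n : ℝ) - t) :=
        Real.rpow_le_rpow (by positivity) hl (by linarith)
      rw [Real.mul_rpow ha0.le hδ.le] at h4
      have h5 := wordValue_pos S hn ht0 l
      have h6 := wordMin_pos S hn l
      calc M * δ ^ ((n : ℝ) - t) * wordValue S t l
          = wordValue S t l * (a ^ ((n : ℝ) - t) * δ ^ ((n : ℝ) - t)) * (κ * ρ) := by
            rw [hM]; ring
        _ ≤ _ := by gcongr
    intro m
    induction m with
    | zero => exact fun l hl hlc => hleaf l hl ((wordMin_le hn hc hS l).trans_lt hlc)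
    | succ m ih =>
      intro l hl hlc
      rw [stopSum]
      split_ifs with hlδ
      · exact hleaf l hl hlδ
      · rw [Finset.mul_sum]
        refine (Finset.sum_le_sum fun i _ => ih (l ++ [i])
          (mul_le_wordMin_append hn ha hδ.le ha0.le (not_lt.1 hlδ) i) ?_).trans
          (sum_measureReal_inter_listMap_le hU hUS hdisj hFb _ l)
        rw [List.length_append, List.length_singleton]
        rwa [show l.length + 1 + m = l.length + (m + 1) by ring]
  refine ⟨ρ, M / K, hρ0, by positivity, fun δ hδ hδ1 => ?_⟩
  obtain ⟨m, hm⟩ := exists_pow_lt_of_lt_one hδ hc1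
  have h1 := key δ hδ m [] (by rw [wordMin_nil S hn]; nlinarith) (by simpa using hm)
  have h2 := one_le_mul_stopSum (wordValue_pos S hn ht0) hK hsub hZ
    (fun l => wordMin S l < δ) m
  have h3 := measureReal_mono (μ := volume) (Set.inter_subset_left
    (s := Metric.thickening (ρ * δ) F) (t := listMap S [] '' U)) hFb.thickening.measure_lt_top.ne
  refine le_trans ?_ (h1.trans h3)
  have hK0 : 0 < K := by linarith
  rw [div_mul_eq_mul_div, div_le_iff₀ hK0]
  have h4 : 0 ≤ M * δ ^ ((n : ℝ) - t) := by positivity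
  nlinarith

end attractor

/-! ### Box dimensions and volumes of thickenings -/

section boxDim

variable {n : ℕ} {E : Set (Euc n)}

/-- The quotient whose lower and upper limits are the box dimensions. -/
noncomputable def boxQuotient (E : Set (Euc n)) (δ : ℝ) : ℝ :=
  Real.log (cubeCoverNumber δ E) / -Real.log δ

theorem eventually_pos_le {a : ℝ} (ha : 0 < a) : ∀ᶠ δ : ℝ in 𝓝[>] 0, 0 < δ ∧ δ ≤ a :=
  Ioc_mem_nhdsGT ha

theorem neg_log_pos_of_le_half {δ : ℝ} (hδ : 0 < δ ∧ δ ≤ 1 / 2) : 0 < -Real.log δ :=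
  neg_pos.2 (Real.log_neg hδ.1 (by linarith [hδ.2]))

theorem eventually_le_mul_neg_log (x : ℝ) {ε : ℝ} (hε : 0 < ε) :
    ∀ᶠ δ : ℝ in 𝓝[>] 0, x ≤ ε * -Real.log δ :=
  ((tendsto_neg_atBot_atTop.comp Real.tendsto_log_nhdsGT_zero).const_mul_atTop
    hε).eventually_ge_atTop x

/-- After taking logarithms, the multiplicative constants become an additive term, absorbed by `ε *
-log δ` for small `δ`. -/
theorem eventually_boxQuotient_le (hE : Bornology.IsBounded E) (hne : E.Nonempty) {t K : ℝ}
    (hK : 0 < K)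
    (h : ∀ δ, 0 < δ → δ ≤ 1 → thickVol δ E ≤ K * δ ^ ((n : ℝ) - t)) {ε : ℝ} (hε : 0 < ε) :
    ∀ᶠ δ in 𝓝[>] 0, boxQuotient E δ ≤ t + ε := by
  obtain ⟨K₁, hK₁, h₁⟩ := exists_cubeCoverNumber_le (n := n)
  filter_upwards [eventually_pos_le one_half_pos,
    eventually_le_mul_neg_log (Real.log (K₁ * K)) hε] with δ hδ hδε
  have hL := neg_log_pos_of_le_half hδ
  have hN : (1 : ℝ) ≤ cubeCoverNumber δ E := by exact_mod_cast cubeCoverNumber_pos hE hne hδ.1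
  have h2 := (h₁ E δ hE hδ.1).trans
    (mul_le_mul_of_nonneg_left (h δ hδ.1 (by linarith [hδ.2])) hK₁.le)
  have hδn : 0 < δ ^ n := pow_pos hδ.1 n
  have hδt : 0 < δ ^ ((n : ℝ) - t) := Real.rpow_pos_of_pos hδ.1 _
  have h3 := Real.log_le_log (by positivity) h2
  rw [Real.log_mul (by positivity) hδn.ne', ← mul_assoc, Real.log_mul (by positivity) hδt.ne',
    Real.log_pow, Real.log_rpow hδ.1] at h3
  rw [boxQuotient, div_le_iff₀ hL]
  linarith

theorem eventually_le_boxQuotient (hE : Bornology.IsBounded E) {t ρ κ : ℝ} (hρ : 0 < ρ)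
    (hκ : 0 < κ)
    (h : ∀ δ, 0 < δ → δ ≤ 1 → κ * δ ^ ((n : ℝ) - t) ≤ thickVol (ρ * δ) E) {ε : ℝ} (hε : 0 < ε) :
    ∀ᶠ δ in 𝓝[>] 0, t - ε ≤ boxQuotient E δ := by
  obtain ⟨K, hK, h₁⟩ := exists_thickVol_le (n := n)
  filter_upwards [eventually_pos_le one_half_pos, eventually_pos_le hρ,
    eventually_le_mul_neg_log (((n : ℝ) - t) * Real.log ρ + Real.log K - Real.log κ) hε]
    with δ hδ hδρ hδε
  have hL := neg_log_pos_of_le_half hδ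
  have h2 := (h (δ / ρ) (div_pos hδ.1 hρ) ((div_le_one hρ).2 hδρ.2)).trans
    (le_of_eq (by rw [mul_div_cancel₀ _ hρ.ne']))
  have h3 := h2.trans (h₁ E δ hE hδ.1)
  have hδt : 0 < (δ / ρ) ^ ((n : ℝ) - t) := Real.rpow_pos_of_pos (div_pos hδ.1 hρ) _
  have hδn : 0 < δ ^ n := pow_pos hδ.1 n
  have hN : (0 : ℝ) < cubeCoverNumber δ E := by
    have h4 : 0 < K * (cubeCoverNumber δ E * δ ^ n) := (mul_pos hκ hδt).trans_le h3
    exact pos_of_mul_pos_left (pos_of_mul_pos_right h4 hK.le) hδn.le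
  have h4 := Real.log_le_log (by positivity) h3
  rw [Real.log_mul hκ.ne' hδt.ne', Real.log_mul hK.ne' (by positivity),
    Real.log_mul hN.ne' hδn.ne', Real.log_pow, Real.log_rpow (div_pos hδ.1 hρ),
    Real.log_div hδ.1.ne' hρ.ne'] at h4
  rw [boxQuotient, le_div_iff₀ hL]
  linarith

/-- This is the volume bound for `t = n`. It keeps the box quotients bounded above, so that their
limits superior and inferior in `ℝ` are genuine. -/
theorem thickVol_le_of_bounded (hE : Bornology.IsBounded E) :
    ∀ δ, 0 < δ → δ ≤ 1 → thickVol δ E ≤ (thickVol 1 E + 1) * δ ^ ((n : ℝ) - n) := by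
  intro δ _ hδ1
  rw [sub_self, Real.rpow_zero, mul_one]
  linarith [thickVol_mono hE hδ1 subset_rfl]

theorem isBoundedUnder_le_boxQuotient (hE : Bornology.IsBounded E) (hne : E.Nonempty) :
    (𝓝[>] (0 : ℝ)).IsBoundedUnder (· ≤ ·) (boxQuotient E) :=
  isBoundedUnder_of_eventually_le (eventually_boxQuotient_le hE hne
    (by linarith [thickVol_nonneg 1 E]) (thickVol_le_of_bounded hE) one_pos)

theorem isBoundedUnder_ge_boxQuotient (hE : Bornology.IsBounded E) (hne : E.Nonempty) :
    (𝓝[>] (0 : ℝ)).IsBoundedUnder (· ≥ ·) (boxQuotient E) := by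
  refine isBoundedUnder_of_eventually_ge (a := 0) ?_
  filter_upwards [eventually_pos_le one_half_pos] with δ hδ
  have hN : (1 : ℝ) ≤ cubeCoverNumber δ E := by exact_mod_cast cubeCoverNumber_pos hE hne hδ.1
  exact div_nonneg (Real.log_nonneg hN) (neg_log_pos_of_le_half hδ).le

theorem upperBoxDim_le (hE : Bornology.IsBounded E) (hne : E.Nonempty) {t K : ℝ} (hK : 0 < K)
    (h : ∀ δ, 0 < δ → δ ≤ 1 → thickVol δ E ≤ K * δ ^ ((n : ℝ) - t)) : upperBoxDim E ≤ t :=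
  le_of_forall_pos_le_add fun _ hε => limsup_le_of_le
    (isBoundedUnder_ge_boxQuotient hE hne).isCoboundedUnder_le
    (eventually_boxQuotient_le hE hne hK h hε)

theorem le_lowerBoxDim (hE : Bornology.IsBounded E) (hne : E.Nonempty) {t ρ κ : ℝ} (hρ : 0 < ρ)
    (hκ : 0 < κ)
    (h : ∀ δ, 0 < δ → δ ≤ 1 → κ * δ ^ ((n : ℝ) - t) ≤ thickVol (ρ * δ) E) :
    t ≤ lowerBoxDim E :=
  le_of_forall_pos_sub_le fun _ hε => le_liminf_of_le
    (isBoundedUnder_le_boxQuotient hE hne).isCoboundedUnder_ge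
    (eventually_le_boxQuotient hE hρ hκ h hε)

theorem lowerBoxDim_le_upperBoxDim (hE : Bornology.IsBounded E) (hne : E.Nonempty) :
    lowerBoxDim E ≤ upperBoxDim E :=
  liminf_le_limsup (isBoundedUnder_le_boxQuotient hE hne) (isBoundedUnder_ge_boxQuotient hE hne)

theorem eventually_boxQuotient_mono {E' : Set (Euc n)} (hE' : Bornology.IsBounded E')
    (hne : E.Nonempty) (h : E ⊆ E') : boxQuotient E ≤ᶠ[𝓝[>] 0] boxQuotient E' := by
  filter_upwards [eventually_pos_le one_half_pos] with δ hδ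
  have hN : 1 ≤ cubeCoverNumber δ E := cubeCoverNumber_pos (hE'.subset h) hne hδ.1
  have hN' := cubeCoverNumber_mono hE' h hδ.1
  have hL := neg_log_pos_of_le_half hδ
  unfold boxQuotient
  gcongr

theorem upperBoxDim_mono {E' : Set (Euc n)} (hE' : Bornology.IsBounded E') (hne : E.Nonempty)
    (h : E ⊆ E') : upperBoxDim E ≤ upperBoxDim E' :=
  limsup_le_limsup (eventually_boxQuotient_mono hE' hne h)
    (isBoundedUnder_ge_boxQuotient (hE'.subset h) hne).isCoboundedUnder_le
    (isBoundedUnder_le_boxQuotient hE' (hne.mono h))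

theorem lowerBoxDim_mono {E' : Set (Euc n)} (hE' : Bornology.IsBounded E') (hne : E.Nonempty)
    (h : E ⊆ E') : lowerBoxDim E ≤ lowerBoxDim E' :=
  liminf_le_liminf (eventually_boxQuotient_mono hE' hne h)
    (isBoundedUnder_ge_boxQuotient (hE'.subset h) hne)
    (isBoundedUnder_le_boxQuotient hE' (hne.mono h)).isCoboundedUnder_ge

theorem exists_thickVol_le_of_upperBoxDim_lt (hE : Bornology.IsBounded E) (hne : E.Nonempty)
    {t : ℝ} (ht : upperBoxDim E < t) (htn : t ≤ n) :
    ∃ K, ∀ δ, 0 < δ → δ ≤ 1 → thickVol δ E ≤ K * δ ^ ((n : ℝ) - t) := by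
  obtain ⟨K₁, hK₁, h₁⟩ := exists_thickVol_le (n := n)
  have hev := (eventually_lt_of_limsup_lt ht (isBoundedUnder_le_boxQuotient hE hne)).and
    (eventually_pos_le one_half_pos)
  obtain ⟨δ₀, hδ₀, hsub⟩ := mem_nhdsGT_iff_exists_Ioo_subset.1 hev
  have hδ₀' : 0 < δ₀ := hδ₀
  -- The first summand handles `δ < δ₀`, where the dimension bound is effective; the second handles
  -- `δ ≥ δ₀` by monotonicity.
  refine ⟨K₁ + thickVol 1 E * (δ₀ ^ ((n : ℝ) - t))⁻¹, fun δ hδ hδ1 => ?_⟩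
  have hV := thickVol_nonneg 1 E
  have hδt : 0 < δ ^ ((n : ℝ) - t) := Real.rpow_pos_of_pos hδ _
  have hδ₀t : 0 < δ₀ ^ ((n : ℝ) - t) := Real.rpow_pos_of_pos hδ₀' _
  rw [add_mul]
  rcases lt_or_ge δ δ₀ with hlt | hge
  · obtain ⟨hq, hδ2⟩ := hsub ⟨hδ, hlt⟩
    have hL := neg_log_pos_of_le_half hδ2
    have hN : (1 : ℝ) ≤ cubeCoverNumber δ E := by exact_mod_cast cubeCoverNumber_pos hE hne hδ
    have h2 : Real.log (cubeCoverNumber δ E) < t * -Real.log δ := (div_lt_iff₀ hL).1 hq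
    have h3 : (cubeCoverNumber δ E : ℝ) ≤ δ ^ (-t) := by
      rw [← Real.log_le_log_iff (by linarith) (Real.rpow_pos_of_pos hδ _), Real.log_rpow hδ]
      linarith
    have h4 : δ ^ ((n : ℝ) - t) = δ ^ (-t) * δ ^ n := by
      rw [← Real.rpow_natCast, ← Real.rpow_add hδ]
      congr 1
      ring
    refine (h₁ E δ hE hδ).trans (le_add_of_le_of_nonneg ?_ (by positivity))
    rw [h4]
    gcongr
  · refine (thickVol_mono hE hδ1 subset_rfl).trans (le_add_of_nonneg_of_le (by positivity) ?_)
    rw [mul_assoc]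
    refine le_mul_of_one_le_right hV ?_
    rw [inv_mul_eq_div, one_le_div hδ₀t]
    exact Real.rpow_le_rpow hδ₀'.le hge (by linarith)

end boxDim

/-! ### Consequences of the projection hypothesis, and the theorem. -/

theorem nonempty_of_infHyperplaneProjection_pos {n : ℕ} (hn : 1 ≤ n) {C : Set (Euc n)}
    (hC : IsCompact C) (hproj : 0 < infHyperplaneProjection C) : C.Nonempty := by
  obtain ⟨κ, hκ, h⟩ := exists_mul_le_measure_sweep hn hC hproj
  by_contra hne
  rw [Set.not_nonempty_iff_eq_empty] at hne
  have := h (EuclideanSpace.single ⟨0, hn⟩ 1) (by simp) 1 zero_le_one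
  rw [hne, sweep, Set.empty_prod, Set.image_empty, measureReal_empty] at this
  linarith

/-- One direction suffices: the sweep of size `δ` lies in the `2 * δ`-neighbourhood of `C` and has
volume at least `κ * δ`. -/
theorem sub_one_le_lowerBoxDim {n : ℕ} (hn : 1 ≤ n) {C : Set (Euc n)}
    (hC : IsCompact C) (hproj : 0 < infHyperplaneProjection C) :
    (n : ℝ) - 1 ≤ lowerBoxDim C := by
  obtain ⟨κ, hκ, h⟩ := exists_mul_le_measure_sweep hn hC hproj
  refine le_lowerBoxDim hC.isBounded (nonempty_of_infHyperplaneProjection_pos hn hC hproj)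
    two_pos hκ fun δ hδ _ => ?_
  have hv : ‖(EuclideanSpace.single ⟨0, hn⟩ 1 : Euc n)‖ = 1 := by simp
  rw [sub_sub_cancel, Real.rpow_one]
  exact (h _ hv δ hδ.le).trans (measureReal_mono
    (sweep_subset_thickening C hv (by linarith)) hC.isBounded.thickening.measure_lt_top.ne)

theorem proposition2p4 {n N : ℕ} (hn : 1 ≤ n) (hN : 1 ≤ N)
    (S : Fin N → (Euc n ≃ᵃ[ℝ] Euc n)) (hS : ∀ i, IsContracting (S i))
    (C : Set (Euc n)) (hC : IsCompact C) (F : Set (Euc n))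
    (hF : IsInhomogeneousAttractor S C F) (hosc : CondensationOSC S C)
    (hproj : 0 < infHyperplaneProjection C) :
    (∃! s : ℝ, IsAffinityDimension S s) ∧
    ∀ s : ℝ, IsAffinityDimension S s →
      upperBoxDim F = max s (upperBoxDim C) ∧
      max s (lowerBoxDim C) ≤ lowerBoxDim F ∧
      lowerBoxDim F ≤ max s (upperBoxDim C) := by
  have : Nonempty (Fin N) := ⟨⟨0, hN⟩⟩
  obtain ⟨c, hc, hc1, hSc⟩ := exists_common_contraction hN hS
  have hP := isPressureFamily_levelSum hn hN hc hc1 hSc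
  constructor
  · have hroot : ∀ k, 1 ≤ k → ∃ r, IsAffinityRoot S k r := fun k hk => by
      obtain ⟨r, hr⟩ := hP.exists_root hk
      exact ⟨r, (isAffinityRoot_iff S).2 hr⟩
    choose! r hr using hroot
    obtain ⟨s, hs⟩ := hP.exists_tendsto_root fun k hk => (isAffinityRoot_iff S).1 (hr k hk)
    refine ⟨s, ⟨r, hr, hs⟩, ?_⟩
    rintro s' ⟨r', hr', hs'⟩
    refine tendsto_nhds_unique (hs'.congr' ?_) hs
    filter_upwards [eventually_ge_atTop 1] with k hk
    have h1 := (isAffinityRoot_iff S).1 (hr k hk)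
    have h2 := (isAffinityRoot_iff S).1 (hr' k hk)
    exact hP.root_unique hk h2.1 h1.1 h2.2 h1.2
  rintro s ⟨r, hr, hs⟩
  replace hr := fun k hk => (isAffinityRoot_iff S).1 (hr k hk)
  have hFb := hF.isCompact.isBounded
  have hFne := hF.nonempty
  have hCb := hC.isBounded
  have hCne := nonempty_of_infHyperplaneProjection_pos hn hC hproj
  have hCdim := sub_one_le_lowerBoxDim hn hC hproj
  have hCdim' := hCdim.trans (lowerBoxDim_le_upperBoxDim hCb hCne)
  have hCF := lowerBoxDim_mono hFb hCne hF.subset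
  obtain ⟨i₀, hi₀⟩ := Finite.exists_min fun i => wordMin S [i]
  have ha0 := wordMin_pos S hn [i₀]
  have ha1 : wordMin S [i₀] < 1 := (wordMin_le hn hc hSc [i₀]).trans_lt (by simpa using hc1)
  -- Needed so that every `t < s` used in the lower bound stays in the range `t ≤ n`.
  have hsn : s ≤ n := by
    by_contra! hlt
    obtain ⟨B, hB⟩ := exists_levelSum_natCast_le hn hF hc hc1 hSc hCne hosc
    obtain ⟨k, hk⟩ := ((hP.tendsto_atTop_of_lt hr hs (by positivity) hlt).eventually_gt_atTop
      B).exists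
    exact absurd (hB k) (not_le.2 hk)
  have hupper : upperBoxDim F ≤ max s (upperBoxDim C) := by
    refine le_of_forall_gt_imp_ge_of_dense fun t ht => ?_
    obtain ⟨hst, hCt⟩ := max_lt_iff.1 ht
    rcases le_total t n with htn | htn
    · obtain ⟨K, hK⟩ := exists_thickVol_le_of_upperBoxDim_lt hCb hCne hCt htn
      obtain ⟨K', hK', h⟩ := exists_thickVol_attractor_le hn hF hc hc1 hSc ha0 ha1 hi₀
        (hCdim'.trans hCt.le) htn (hP.summable_of_gt hr hs hst) hK
      exact upperBoxDim_le hFb hFne hK' h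
    · exact (upperBoxDim_le hFb hFne (by linarith [thickVol_nonneg 1 F])
        (thickVol_le_of_bounded hFb)).trans htn
  have hlower : s ≤ lowerBoxDim F := by
    rcases le_or_gt s (n - 1) with hle | hlt
    · exact hle.trans (hCdim.trans hCF)
    obtain ⟨κ, hκ, hsweep⟩ := exists_mul_le_measure_sweep hn hC hproj
    refine le_of_forall_lt_imp_le_of_dense fun t ht => ?_
    have hn1 : (1 : ℝ) ≤ n := by exact_mod_cast hn
    -- Raising `t` to at least `n - 1` puts it in the range of the determinant formula while keeping
    -- it below `s`.
    have ht' : max t (n - 1) < s := max_lt ht hlt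
    obtain ⟨ρ, κ', hρ, hκ', h⟩ := exists_le_thickVol_attractor hn hF hC hc hc1 hSc ha0 ha1 hi₀
      hosc hκ hsweep (le_max_right t _) (ht'.le.trans hsn)
      (hP.tendsto_atTop_of_lt hr hs (le_max_of_le_right (by linarith)) ht')
    exact (le_max_left _ _).trans (le_lowerBoxDim hFb hFne hρ hκ' h)
  have hFF := lowerBoxDim_le_upperBoxDim hFb hFne
  exact ⟨le_antisymm hupper (max_le (hlower.trans hFF) (upperBoxDim_mono hFb hCne hF.subset)),
    max_le hlower hCF, hFF.trans hupper⟩
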